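/- **Conventions.** A *biquandle* is a set $X$ with two binary operations $\underline{*},\overline{*}$ such that (1) $x\,\underline{*}\,x=x\,\overline{*}\,x$; (2) the maps $\bullet\,\underline{*}\,x$, $\bullet\,\overline{*}\,x$ on $X$ and $(x,y)\mapsto(y\,\overline{*}\,x,\;x\,\underline{*}\,y)$ on $X\times X$ are bijective; (3) $(x\underline{*}y)\underline{*}(z\underline{*}y)=(x\underline{*}z)\underline{*}(y\overline{*}z)$, $(x\overline{*}y)\overline{*}(z\overline{*}y)=(x\overline{*}z)\overline{*}(y\underline{*}z)$, $(x\underline{*}y)\overline{*}(z\underline{*}y)=(x\overline{*}z)\underline{*}(y\overline{*}z)$. Write $\overline{*}^{-1}$ for the inverse operation: $(x\,\overline{*}\,y)\,\overline{*}^{-1}y=x$. Let $\mathcal Q(X)$ be the set $X$ with the quandle operation $x*y=(x\,\underline{*}\,y)\,\overline{*}^{-1}y$; a quandle is regarded as a biquandle with $\underline{*}=*$ and $x\,\overline{*}\,y=x$. Let $k\colon X\to X$ be the bijection with $k(x)\,\overline{*}\,k(x)=x$, and $$\mathrm{As}(X)=\langle x\ (x\in X)\mid x\cdot(y\,\overline{*}\,x)=y\cdot(x\,\underline{*}\,y)\rangle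 .$$ Let $D\subset\mathbb R^2$ be an oriented link diagram. The normal vector of a strand is its tangent vector turned by $+90^\circ$. An $X$-coloring is a map $\mathcal C\colon\mathcal{SA}(D)\to X$ on the semi-arcs such that at every crossing $\mathcal C(\sigma_i)\,\underline{*}\,\mathcal C(\sigma_j)=\mathcal C(\sigma_k)$ and $\mathcal C(\sigma_j)\,\overline{*}\,\mathcal C(\sigma_i)=\mathcal C(\sigma_l)$, where the normal vector of the over-strand points from the side of the under-semi-arc $\sigma_i$ to that of the under-semi-arc $\sigma_k$, and the normal vector of the under-strand points from the side of the over-semi-arc $\sigma_j$ to that of the over-semi-arc $\sigma_l$. For a quandle $Q$, a $Q$-coloring is a map on the arcs of $D$ with $\mathcal C(\alpha_i)*\mathcal C(\alpha_j)=\mathcal C(\alpha_k)$ for the under-arcs $\alpha_i,\alpha_k$ (on the sides as before) and the over-arc $\alpha_j$; it is also regarded as a map on the semi-arcs. Let $\mathrm{Col}_X(D)$, $\mathrm{Col}_Q(D)$ be the sets of colorings. The region coloring $\mathcal C^R\colon\mathcal R(D)\to\mathrm{As}(X)$ of a coloring $\mathcal C$ is the unique map with value $e$ on the unbounded region and $\mathcal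 C^R(R_1)\cdot\mathcal C(\sigma)=\mathcal C^R(R_2)$ whenever the normal vector of $\sigma$ points from the region $R_1=:\rho_\sigma$ to $R_2$; the shadow coloring is $\mathcal C^S(\sigma)=(\mathcal C^R(\rho_\sigma),\mathcal C(\sigma))\in\mathrm{As}(X)\times X$. **The map $\Psi$.** Let $W(D)$ be the diagram obtained by putting $-D^v$ ($D$ with orientation and all crossings reversed), slightly pushed in the direction of the normal vectors of $D$, behind $D$. Cut $D$ by horizontal levels into strips, each containing one crossing, one local maximum or one local minimum; a neighborhood of each level is a trivial tangle of vertical strings. For $\mathcal C\in\mathrm{Col}_{\mathcal Q(X)}(D)$ let $E\in\mathrm{Col}_X(W(D))$ be the coloring in which, at every level, both strings parallel to a string of $D$ have the color given by $\mathcal C$. In the neighborhood of each level, pull $-D^v$ away by Reidemeister moves of type II: move its leftmost string behind all other strings to the far right, then the second one to the left of the first, and so on. The coloring induced by $E$ then gives colors to the remaining strings of $D$ at that level; these are the colors of the coloring $\Psi(\mathcal C)$. **The maps $\psi,\psi_{\mathrm{As}}$.** Define $\psi\colon\mathrm{As}(\mathcal Q(X))\times\mathcal Q(X)\to X$ and $\psi_{\mathrm{As}}\colon\mathrm{As}(\mathcal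 Q(X))\to\mathrm{As}(X)$ by $$\psi(e,a)=a,\qquad \psi(p\cdot b,a)=\psi(p,a)\,\overline{*}\,\psi(p,b),\qquad \psi(p\cdot b^{-1},a)=\psi(p,a)\,\overline{*}^{-1}k(\psi(p,b)),$$ $$\psi_{\mathrm{As}}(e)=e,\qquad \psi_{\mathrm{As}}(p\cdot a)=\psi_{\mathrm{As}}(p)\cdot\psi(p,a),\qquad \psi_{\mathrm{As}}(p\cdot a^{-1})=\psi_{\mathrm{As}}(p)\cdot\psi(p\cdot a^{-1},a)^{-1},$$ and let $\tilde\psi(p,a)=(\psi_{\mathrm{As}}(p),\psi(p,a))$. **Proposition.** For every biquandle $X$ and every oriented link diagram $D$, the construction above gives a well-defined bijection $\Psi\colon\mathrm{Col}_{\mathcal Q(X)}(D)\to\mathrm{Col}_X(D)$, and for every $\mathcal C\in\mathrm{Col}_{\mathcal Q(X)}(D)$ $$(\Psi(\mathcal C))^S=\tilde\psi\circ\mathcal C^S\qquad\text{as maps }\mathcal{SA}(D)\to\mathrm{As}(X)\times X .$$ -/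

import Mathlib

universe u

namespace KnotColor

/-! ### Biquandles -/

/-- A biquandle: `ust x y` is the operation `x` underline-star `y`, and `ost x y` is
`x` overline-star `y`. -/
class Biquandle (X : Type u) where
  ust : X → X → X
  ost : X → X → X
  under_self : ∀ x, ust x x = ost x x
  under_bij : ∀ y, Function.Bijective fun x => ust x y
  over_bij : ∀ y, Function.Bijective fun x => ost x y
  switch_bij : Function.Bijective fun p : X × X => (ost p.2 p.1, ust p.1 p.2)
  under_under : ∀ x y z, ust (ust x y) (ust z y) = ust (ust x z) (ost y z)
  over_over : ∀ x y z, ost (ost x y) (ost z y) = ost (ost x z) (ust y z)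
  under_over : ∀ x y z, ost (ust x y) (ust z y) = ust (ost x z) (ost y z)

section Biquandle

open Biquandle

variable {X : Type u} [Biquandle X]

/-- The inverse `x` overline-star-inverse `y`. -/
noncomputable def overInv (x y : X) : X := (Equiv.ofBijective _ (over_bij y)).symm x

/-- The inverse `x` underline-star-inverse `y`. -/
noncomputable def underInv (x y : X) : X := (Equiv.ofBijective _ (under_bij y)).symm x

theorem over_overInv (x y : X) : ost (overInv x y) y = x :=
  (Equiv.ofBijective _ (over_bij y)).apply_symm_apply x

theorem overInv_over (x y : X) : overInv (ost x y) y = x :=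
  (Equiv.ofBijective _ (over_bij y)).symm_apply_apply x

theorem under_underInv (x y : X) : ust (underInv x y) y = x :=
  (Equiv.ofBijective _ (under_bij y)).apply_symm_apply x

theorem underInv_under (x y : X) : underInv (ust x y) y = x :=
  (Equiv.ofBijective _ (under_bij y)).symm_apply_apply x

theorem over_cancel {x x' : X} (y : X) (h : ost x y = ost x' y) : x = x' :=
  (over_bij y).1 h

theorem under_cancel {x x' : X} (y : X) (h : ust x y = ust x' y) : x = x' :=
  (under_bij y).1 h

theorem diag_bij : Function.Bijective fun x : X => ost x x := by
  have inj : ∀ x x' : X, ost x x = ost x' x' → x = x' := by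
    intro x x' h
    have := (switch_bij (X := X)).1 (a₁ := (x, x)) (a₂ := (x', x'))
      (by simp [under_self, h])
    exact congrArg Prod.fst this
  refine ⟨fun x x' h => inj x x' h, fun y => ?_⟩
  obtain ⟨⟨s, t⟩, h⟩ := (switch_bij (X := X)).2 (y, y)
  simp only [Prod.mk.injEq] at h
  obtain ⟨h1, h2⟩ := h
  have e1 := under_under s t s
  rw [h1, h2] at e1
  have e1' := under_cancel _ e1
  refine ⟨s, ?_⟩
  show ost s s = y
  rw [← under_self, ← e1']

/-- The bijection `k : X → X` with `ost (k x) (k x) = x`. -/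
noncomputable def kMap : X ≃ X := (Equiv.ofBijective _ (diag_bij (X := X))).symm

theorem over_kMap (x : X) : ost (kMap x) (kMap x) = x :=
  (Equiv.ofBijective _ (diag_bij (X := X))).apply_symm_apply x

theorem kMap_over (x : X) : kMap (ost x x) = x :=
  (Equiv.ofBijective _ (diag_bij (X := X))).symm_apply_apply x

/-- The derived operation `x * y = (x underline-star y) overline-star-inverse y`. -/
noncomputable def qop (x y : X) : X := overInv (ust x y) y

theorem over_qop (x y : X) : ost (qop x y) y = ust x y := over_overInv _ _

theorem over_qop_distrib (a b c : X) :
    ost (qop a b) c = qop (ost a c) (ost b c) := by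
  apply over_cancel (ost b c)
  rw [over_qop, over_over, over_qop, under_over]

theorem under_qop_distrib (a b c : X) :
    ust (qop a b) c = qop (ust a c) (ust b c) := by
  apply over_cancel (ust b c)
  rw [over_qop, under_over, over_qop, under_under]

theorem overInv_qop_distrib (a b c : X) :
    overInv (qop a b) c = qop (overInv a c) (overInv b c) := by
  apply over_cancel c
  rw [over_overInv, over_qop_distrib, over_overInv, over_overInv]

theorem qop_self (x : X) : qop x x = x := by
  rw [qop, under_self, overInv_over]

theorem qop_distrib (a b c : X) : qop (qop a b) c = qop (qop a c) (qop b c) := by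
  conv_lhs => rw [qop, under_qop_distrib, overInv_qop_distrib]
  rfl

end Biquandle

/-- The underlying set of `Q(X)`. -/
def Qdl (X : Type u) : Type u := X

/-- The identity map `Q(X) → X` of underlying sets. -/
def Qdl.out {X : Type u} (a : Qdl X) : X := a

/-- The quandle `Q(X)`.  Mathlib writes quandles with a left action; a right-handed
quandle operation `a * b` is Mathlib's `b ◃ a`. -/
noncomputable instance (X : Type u) [Biquandle X] : Quandle (Qdl X) where
  act b a := qop (X := X) a b
  invAct b a := underInv (X := X) (Biquandle.ost (X := X) a b) b
  self_distrib {c b a} := qop_distrib (X := X) a b c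
  left_inv b a := (congrArg (fun t : X => underInv t b) (over_qop (X := X) a b)).trans
    (underInv_under (X := X) a b)
  right_inv b a := (congrArg (fun t : X => overInv t b)
    (under_underInv (X := X) (Biquandle.ost (X := X) a b) b)).trans (overInv_over (X := X) a b)
  fix {x} := qop_self (X := X) x

open Quandles in
/-- A quandle regarded as a biquandle with trivial over-operation. -/
abbrev Biquandle.ofQuandle (Q : Type u) [Quandle Q] : Biquandle Q where
  ust a b := b ◃ a
  ost a _ := a
  under_self x := Quandle.fix
  under_bij y := (Rack.act' y).bijective
  over_bij _ := Function.bijective_id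
  switch_bij := by
    constructor
    · rintro ⟨x, y⟩ ⟨x', y'⟩ h
      simp only [Prod.mk.injEq] at h
      obtain ⟨rfl, h⟩ := h
      rw [(Rack.act' y).injective h]
    · rintro ⟨y, z⟩
      exact ⟨(y ◃⁻¹ z, y), by simp⟩
  under_under _ _ _ := Shelf.self_distrib.symm
  over_over _ _ _ := rfl
  under_over _ _ _ := rfl

noncomputable instance (X : Type u) [Biquandle X] : Biquandle (Qdl X) :=
  Biquandle.ofQuandle (Qdl X)

/-! ### The associated group -/

/-- The relations `x · (y overline-star x) = y · (x underline-star y)`. -/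
def asRels (X : Type u) [Biquandle X] : Set (FreeGroup X) :=
  {r | ∃ x y : X, r =
    (FreeGroup.of x * FreeGroup.of (Biquandle.ost y x)) *
      (FreeGroup.of y * FreeGroup.of (Biquandle.ust x y))⁻¹}

/-- The associated group `As(X)`. -/
abbrev As (X : Type u) [Biquandle X] : Type u := PresentedGroup (asRels X)

/-- An element of `X` regarded as an element of `As(X)`. -/
def As.of {X : Type u} [Biquandle X] (x : X) : As X := PresentedGroup.of x

theorem As.rel {X : Type u} [Biquandle X] (x y : X) :
    As.of x * As.of (Biquandle.ost y x) = As.of y * As.of (Biquandle.ust x y) := by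
  have h : PresentedGroup.mk (asRels X)
      ((FreeGroup.of x * FreeGroup.of (Biquandle.ost y x)) *
      (FreeGroup.of y * FreeGroup.of (Biquandle.ust x y))⁻¹) = 1 :=
    (PresentedGroup.one_of_mem ⟨x, y, rfl⟩)
  rw [map_mul, map_inv, mul_inv_eq_one] at h
  exact h

/-! ### The maps `ψ`, `ψ_As` and `ψ̃`

The recursive clauses for `ψ(p · b^{±1}, -)` and `ψ_As(p · b^{±1})` only involve `b`,
`ψ(p, -)` and `ψ_As(p)`: they describe a permutation, depending on `b`, of the set of pairs
`(ψ_As(p), ψ(p, -))`.  The recursion is solved by letting `As(Q(X))` act, from the right,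
on pairs `(g, f)` with `g ∈ As(X)` and `f` a quandle homomorphism from `Q(X)` to itself. -/

section Psi

open Quandles

variable {X : Type u} [Biquandle X]

/-- Pairs `(g, f)` on which `As(Q(X))` acts. -/
abbrev PsiState (X : Type u) [Biquandle X] : Type u :=
  As X × {f : Qdl X → X // ∀ a b : Qdl X, f (b ◃ a) = qop (f a) (f b)}

/-- The action of a generator `b` on pairs: `(g, f)` goes to the pair of `g · f(b)` and
`a ↦ f(a) overline-star f(b)`. -/
noncomputable def psiStep (b : Qdl X) : Equiv.Perm (PsiState X) where
  toFun s := (s.1 * As.of (s.2.1 b),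
    ⟨fun a => Biquandle.ost (s.2.1 a) (s.2.1 b), fun x y => by
      beta_reduce
      rw [s.2.2, over_qop_distrib]⟩)
  invFun s := (s.1 * (As.of (overInv (s.2.1 b) (kMap (s.2.1 b))))⁻¹,
    ⟨fun a => overInv (s.2.1 a) (kMap (s.2.1 b)), fun x y => by
      beta_reduce
      rw [s.2.2, overInv_qop_distrib]⟩)
  left_inv := by
    rintro ⟨g, f, hf⟩
    refine Prod.ext ?_ (Subtype.ext ?_)
    · simp [kMap_over, overInv_over]
    · funext a
      simp [kMap_over, overInv_over]
  right_inv := by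
    rintro ⟨g, f, hf⟩
    have key : overInv (f b) (kMap (f b)) = kMap (f b) := by
      apply over_cancel (kMap (f b))
      rw [over_overInv, over_kMap]
    refine Prod.ext ?_ (Subtype.ext ?_)
    · simp
    · funext a
      simp [key, over_overInv]

theorem psiStep_rel (x y : Qdl X) (s : PsiState X) :
    psiStep y (psiStep x s) = psiStep (Biquandle.ust x y) (psiStep y s) := by
  obtain ⟨g, f, hf⟩ := s
  have h1 : Biquandle.ost (f (Biquandle.ust x y)) (f y) = Biquandle.ust (f x) (f y) := by
    rw [show f (Biquandle.ust x y) = qop (f x) (f y) from hf x y, over_qop]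
  refine Prod.ext ?_ (Subtype.ext ?_)
  · show g * As.of (f x) * As.of (Biquandle.ost (f y) (f x))
      = g * As.of (f y) * As.of (Biquandle.ost (f (Biquandle.ust x y)) (f y))
    rw [h1, mul_assoc, mul_assoc, As.rel]
  · funext a
    show Biquandle.ost (Biquandle.ost (f a) (f x)) (Biquandle.ost (f y) (f x))
      = Biquandle.ost (Biquandle.ost (f a) (f y)) (Biquandle.ost (f (Biquandle.ust x y)) (f y))
    rw [h1, Biquandle.over_over]

/-- The right action of `As(Q(X))` on pairs. -/
noncomputable def psiAct (X : Type u) [Biquandle X] :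
    As (Qdl X) →* (Equiv.Perm (PsiState X))ᵐᵒᵖ :=
  PresentedGroup.toGroup (f := fun b : Qdl X => MulOpposite.op (psiStep b)) (by
    rintro r ⟨x, y, rfl⟩
    simp only [map_mul, map_inv, FreeGroup.lift_apply_of]
    rw [mul_inv_eq_one]
    apply MulOpposite.unop_injective
    ext1 s
    exact psiStep_rel x y s)

/-- The pair `(ψ_As(p), ψ(p, -))`. -/
noncomputable def psiPair (p : As (Qdl X)) : PsiState X :=
  (psiAct X p).unop (1, ⟨Qdl.out, fun _ _ => rfl⟩)

/-- The map `ψ : As(Q(X)) × Q(X) → X`. -/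
noncomputable def psi (p : As (Qdl X)) (a : Qdl X) : X := (psiPair p).2.1 a

/-- The map `ψ_As : As(Q(X)) → As(X)`. -/
noncomputable def psiAs (p : As (Qdl X)) : As X := (psiPair p).1

/-- The map `ψ̃ = (ψ_As, ψ) : As(Q(X)) × Q(X) → As(X) × X`. -/
noncomputable def psiTilde (s : As (Qdl X) × Qdl X) : As X × X := (psiAs s.1, psi s.1 s.2)

theorem psiPair_mul_of (p : As (Qdl X)) (b : Qdl X) :
    psiPair (p * As.of b) = psiStep b (psiPair p) := by
  simp [psiPair, psiAct, As.of]

theorem psiPair_mul_of_inv (p : As (Qdl X)) (b : Qdl X) :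
    psiPair (p * (As.of b)⁻¹) = (psiStep b).symm (psiPair p) := by
  rw [Equiv.eq_symm_apply, ← psiPair_mul_of, inv_mul_cancel_right]

/-! The recursive clauses that determine `ψ` and `ψ_As`. -/

theorem psi_one (a : Qdl X) : psi 1 a = a.out := by
  simp [psi, psiPair]

theorem psi_mul_of (p : As (Qdl X)) (b a : Qdl X) :
    psi (p * As.of b) a = Biquandle.ost (psi p a) (psi p b) := by
  rw [psi, psiPair_mul_of]; rfl

theorem psi_mul_of_inv (p : As (Qdl X)) (b a : Qdl X) :
    psi (p * (As.of b)⁻¹) a = overInv (psi p a) (kMap (psi p b)) := by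
  rw [psi, psiPair_mul_of_inv]; rfl

theorem psiAs_one : psiAs (1 : As (Qdl X)) = 1 := by
  simp [psiAs, psiPair]

theorem psiAs_mul_of (p : As (Qdl X)) (a : Qdl X) :
    psiAs (p * As.of a) = psiAs p * As.of (psi p a) := by
  rw [psiAs, psiPair_mul_of]; rfl

theorem psiAs_mul_of_inv (p : As (Qdl X)) (a : Qdl X) :
    psiAs (p * (As.of a)⁻¹) = psiAs p * (As.of (psi (p * (As.of a)⁻¹) a))⁻¹ := by
  rw [psiAs, psi, psiPair_mul_of_inv]; rfl

end Psi

/-! ### Oriented tangle and link diagrams, sliced into horizontal strips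

A diagram in general position with respect to the height is cut into horizontal strips, each of
which contains exactly one crossing, local maximum or local minimum.  A horizontal level between
two strips meets the diagram in finitely many points, read from left to right and recorded as a
word of orientations: `true` for a string directed downwards, `false` for upwards. -/

/-- One strip.  In each case `l` and `r` are the orientations of the vertical strings to the left
and to the right of the elementary part.

* `cross l r a b o`: strand `A`, of orientation `a`, runs from top left to bottom right and strand
  `B`, of orientation `b`, from top right to bottom left; `A` is the over-strand iff `o = true`.
* `birth l r a`: a local maximum; below it there are two new strings of orientations `a`, `!a`.
* `death l r a`: a local minimum; it ends two strings of orientations `a`, `!a`. -/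
inductive Piece where
  | cross (l r : List Bool) (a b o : Bool)
  | birth (l r : List Bool) (a : Bool)
  | death (l r : List Bool) (a : Bool)

namespace Piece

/-- Orientations of the strings on the upper side of the strip. -/
def top : Piece → List Bool
  | cross l r a b _ => l ++ a :: b :: r
  | birth l r _ => l ++ r
  | death l r a => l ++ a :: (!a) :: r

/-- Orientations of the strings on the lower side of the strip. -/
def bot : Piece → List Bool
  | cross l r a b _ => l ++ b :: a :: r
  | birth l r a => l ++ a :: (!a) :: r
  | death l r _ => l ++ r

/-- The `i`-th string on the upper side continues, without meeting a crossing, to the `k`-th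
string on the lower side. -/
def Through : Piece → ℕ → ℕ → Prop
  | cross l _ _ _ _, i, k => i = k ∧ i ≠ l.length ∧ i ≠ l.length + 1
  | birth l _ _, i, k => (i < l.length ∧ k = i) ∨ (l.length ≤ i ∧ k = i + 2)
  | death l _ _, i, k => (k < l.length ∧ i = k) ∨ (l.length ≤ k ∧ i = k + 2)

/-- The `i`-th and `k`-th strings on the lower side are joined by a local maximum. -/
def JoinedBelow : Piece → ℕ → ℕ → Prop
  | birth l _ _, i, k => i = l.length ∧ k = l.length + 1
  | _, _, _ => False

/-- The `i`-th and `k`-th strings on the upper side are joined by a local minimum. -/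
def JoinedAbove : Piece → ℕ → ℕ → Prop
  | death l _ _, i, k => i = l.length ∧ k = l.length + 1
  | _, _, _ => False

/-- The `i`-th gap on the upper side and the `k`-th gap on the lower side lie in the same
component of the complement of the diagram in the strip.  (The `i`-th gap of a level is the
interval that has exactly `i` strings to its left.) -/
def GapThrough : Piece → ℕ → ℕ → Prop
  | cross l _ _ _ _, i, k => i = k ∧ i ≠ l.length + 1
  | birth l _ _, i, k => (i ≤ l.length ∧ k = i) ∨ (l.length ≤ i ∧ k = i + 2)
  | death l _ _, i, k => (k ≤ l.length ∧ i = k) ∨ (l.length ≤ k ∧ i = k + 2)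

/-- The same strip with `x` more strings on the left and `y` more on the right. -/
def shift (x y : List Bool) : Piece → Piece
  | cross l r a b o => cross (x ++ l) (r ++ y) a b o
  | birth l r a => birth (x ++ l) (r ++ y) a
  | death l r a => death (x ++ l) (r ++ y) a

/-- The strip turned upside down by reflection in a horizontal line (`true` still means downwards, so
every string is reversed as well); a crossing followed by its `flip` is
the side with two crossings of a Reidemeister move of type II. -/
def flip : Piece → Piece
  | cross l r a b o => cross l r b a !o
  | birth l r a => death l r a
  | death l r a => birth l r a

theorem Through.getElem? {s : Piece} {i k : ℕ} (h : s.Through i k) :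
    s.top[i]? = s.bot[k]? := by
  cases s with
  | cross l r a b o =>
    obtain ⟨rfl, h1, h2⟩ := h
    rcases lt_or_ge i l.length with h3 | h3
    · simp [top, bot, List.getElem?_append, h3]
    · obtain ⟨m, rfl⟩ : ∃ m, i = l.length + (m + 2) := ⟨i - l.length - 2, by omega⟩
      simp [top, bot, List.getElem?_append]
  | birth l r a =>
    rcases h with ⟨h, rfl⟩ | ⟨h, rfl⟩
    · simp [top, bot, List.getElem?_append, h]
    · obtain ⟨m, rfl⟩ := Nat.exists_eq_add_of_le h
      rw [add_assoc]
      simp [top, bot, List.getElem?_append]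
  | death l r a =>
    rcases h with ⟨h, rfl⟩ | ⟨h, rfl⟩
    · simp [top, bot, List.getElem?_append, h]
    · obtain ⟨m, rfl⟩ := Nat.exists_eq_add_of_le h
      rw [add_assoc]
      simp [top, bot, List.getElem?_append]

theorem Through.gap {s : Piece} {i k : ℕ} (h : s.Through i k) :
    s.GapThrough i k ∧ s.GapThrough (i + 1) (k + 1) := by
  cases s <;> simp only [Through, GapThrough] at h ⊢ <;> omega

theorem top_shift (x y : List Bool) (p : Piece) : (p.shift x y).top = x ++ p.top ++ y := by
  cases p <;> simp [shift, top]

theorem bot_shift (x y : List Bool) (p : Piece) : (p.shift x y).bot = x ++ p.bot ++ y := by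
  cases p <;> simp [shift, bot]

theorem top_flip (p : Piece) : p.flip.top = p.bot := by cases p <;> rfl

theorem bot_flip (p : Piece) : p.flip.bot = p.top := by cases p <;> rfl

end Piece

/-- The strips `ps` can be stacked, from `u` at the top to `v` at the bottom. -/
def Runs : List Bool → List Piece → List Bool → Prop
  | u, [], v => u = v
  | u, p :: ps, v => p.top = u ∧ Runs p.bot ps v

theorem Runs.append {u v w : List Bool} {ps qs : List Piece} (h : Runs u ps v)
    (h' : Runs v qs w) : Runs u (ps ++ qs) w := by
  induction ps generalizing u with
  | nil => cases h; exact h'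
  | cons p ps ih => exact ⟨h.1, ih h.2⟩

theorem Runs.shift {u v : List Bool} {ps : List Piece} (x y : List Bool) (h : Runs u ps v) :
    Runs (x ++ u ++ y) (ps.map (Piece.shift x y)) (x ++ v ++ y) := by
  induction ps generalizing u with
  | nil => cases h; rfl
  | cons p ps ih =>
    refine ⟨by rw [Piece.top_shift, h.1], ?_⟩
    rw [Piece.bot_shift]
    exact ih h.2

theorem Runs.flip {u v : List Bool} {ps : List Piece} (h : Runs u ps v) :
    Runs v (ps.map Piece.flip).reverse u := by
  induction ps generalizing u with
  | nil => cases h; rfl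
  | cons p ps ih =>
    rw [List.map_cons, List.reverse_cons]
    exact (ih h.2).append ⟨Piece.top_flip p, (Piece.bot_flip p).trans h.1⟩

/-- Orientations of the strings at level `j`; the empty word beyond the last level. -/
def wordAt : List Bool → List Piece → ℕ → List Bool
  | u, _, 0 => u
  | _, [], _ + 1 => []
  | _, p :: ps, j + 1 => wordAt p.bot ps j

theorem wordAt_top {u v : List Bool} {ps : List Piece} (h : Runs u ps v) {j : ℕ} {p : Piece}
    (hp : ps[j]? = some p) : wordAt u ps j = p.top := by
  induction ps generalizing u j with
  | nil => simp at hp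
  | cons q ps ih =>
    cases j with
    | zero => simp at hp; subst hp; exact h.1.symm
    | succ j => exact ih h.2 (by simpa using hp)

theorem wordAt_bot {u v : List Bool} {ps : List Piece} (h : Runs u ps v) {j : ℕ} {p : Piece}
    (hp : ps[j]? = some p) : wordAt u ps (j + 1) = p.bot := by
  induction ps generalizing u j with
  | nil => simp at hp
  | cons q ps ih =>
    cases j with
    | zero => simp at hp; subst hp; cases ps <;> rfl
    | succ j => exact ih h.2 (by simpa using hp)

theorem wordAt_of_lt {u : List Bool} {ps : List Piece} {j : ℕ} (h : ps.length < j) :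
    wordAt u ps j = [] := by
  induction ps generalizing u j with
  | nil => cases j with
    | zero => simp at h
    | succ j => rfl
  | cons q ps ih => cases j with
    | zero => simp at h
    | succ j => exact ih (by simpa using h)

/-- An oriented tangle diagram with upper end points `u` and lower end points `v`. -/
structure Tangle (u v : List Bool) where
  pieces : List Piece
  runs : Runs u pieces v

/-- An oriented link diagram in the plane. -/
abbrev LinkDiagram := Tangle [] []

namespace Tangle

variable {u v : List Bool} (T : Tangle u v)

/-- Orientations of the strings of `T` at level `j`. -/
def word (j : ℕ) : List Bool := wordAt u T.pieces j

variable {T} in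
theorem word_top {j : ℕ} {p : Piece} (hp : T.pieces[j]? = some p) : T.word j = p.top :=
  wordAt_top T.runs hp

variable {T} in
theorem word_bot {j : ℕ} {p : Piece} (hp : T.pieces[j]? = some p) : T.word (j + 1) = p.bot :=
  wordAt_bot T.runs hp

/-- The intersection points of the diagram with the levels. -/
@[ext]
structure Point where
  lvl : ℕ
  pos : ℕ
  pos_lt : pos < (T.word lvl).length

variable {T} in
theorem Point.lvl_le (p : T.Point) : p.lvl ≤ T.pieces.length := by
  by_contra h
  have := p.pos_lt
  rw [word, wordAt_of_lt (not_le.1 h)] at this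
  simp at this

variable {T} in
/-- The orientation of the diagram at a point (`true` is downwards). -/
def Point.dir (p : T.Point) : Bool := (T.word p.lvl)[p.pos]'p.pos_lt

/-- Two points are joined inside one strip, without passing through a crossing. -/
def Adj (p q : T.Point) : Prop :=
  ∃ (j : ℕ) (s : Piece), T.pieces[j]? = some s ∧
    ((p.lvl = j ∧ q.lvl = j + 1 ∧ s.Through p.pos q.pos) ∨
     (p.lvl = j + 1 ∧ q.lvl = j + 1 ∧ s.JoinedBelow p.pos q.pos) ∨
     (p.lvl = j ∧ q.lvl = j ∧ s.JoinedAbove p.pos q.pos))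

/-- The set `SA(T)` of semi-arcs. -/
def SemiArc : Type := Quot T.Adj

variable {T} in
/-- The semi-arc through a point. -/
def Point.semiArc (p : T.Point) : T.SemiArc := Quot.mk _ p

/-- The crossings of `T`. -/
structure Crossing where
  lvl : ℕ
  l : List Bool
  r : List Bool
  a : Bool
  b : Bool
  o : Bool
  get_eq : T.pieces[lvl]? = some (Piece.cross l r a b o)

namespace Crossing

variable {T} (c : T.Crossing)

/-- The four ends of a crossing. -/
def topLeft : T.Point := ⟨c.lvl, c.l.length, by rw [word_top c.get_eq]; simp [Piece.top]⟩
def topRight : T.Point := ⟨c.lvl, c.l.length + 1, by rw [word_top c.get_eq]; simp [Piece.top]⟩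
def botLeft : T.Point := ⟨c.lvl + 1, c.l.length, by rw [word_bot c.get_eq]; simp [Piece.bot]⟩
def botRight : T.Point :=
  ⟨c.lvl + 1, c.l.length + 1, by rw [word_bot c.get_eq]; simp [Piece.bot]⟩

theorem topLeft_dir : c.topLeft.dir = c.a := by
  have h : (T.word (c.lvl))[c.l.length]? = some c.topLeft.dir := List.getElem?_eq_getElem c.topLeft.pos_lt
  rw [word_top c.get_eq] at h
  simp [Piece.top] at h
  exact h.symm

theorem topRight_dir : c.topRight.dir = c.b := by
  have h : (T.word (c.lvl))[c.l.length + 1]? = some c.topRight.dir := List.getElem?_eq_getElem c.topRight.pos_lt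
  rw [word_top c.get_eq] at h
  simp [Piece.top] at h
  exact h.symm

theorem botLeft_dir : c.botLeft.dir = c.b := by
  have h : (T.word (c.lvl + 1))[c.l.length]? = some c.botLeft.dir := List.getElem?_eq_getElem c.botLeft.pos_lt
  rw [word_bot c.get_eq] at h
  simp [Piece.bot] at h
  exact h.symm

theorem botRight_dir : c.botRight.dir = c.a := by
  have h : (T.word (c.lvl + 1))[c.l.length + 1]? = some c.botRight.dir := List.getElem?_eq_getElem c.botRight.pos_lt
  rw [word_bot c.get_eq] at h
  simp [Piece.bot] at h
  exact h.symm

/-! Normal vectors are the tangent vectors turned by `+90` degrees, so that the normal vector of a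
string directed downwards points to the right.  Each of the two strands at a crossing consists of
two semi-arcs; its *source* is the one on the side of the other strand from which the normal
vector of that other strand emanates, and its *target* is the one on the other side. -/

def srcA : T.SemiArc := if c.b then c.topLeft.semiArc else c.botRight.semiArc
def tgtA : T.SemiArc := if c.b then c.botRight.semiArc else c.topLeft.semiArc
def srcB : T.SemiArc := if c.a then c.botLeft.semiArc else c.topRight.semiArc
def tgtB : T.SemiArc := if c.a then c.topRight.semiArc else c.botLeft.semiArc

def underSrc : T.SemiArc := if c.o then c.srcB else c.srcA
def underTgt : T.SemiArc := if c.o then c.tgtB else c.tgtA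
def overSrc : T.SemiArc := if c.o then c.srcA else c.srcB
def overTgt : T.SemiArc := if c.o then c.tgtA else c.tgtB

end Crossing

/-- The set `A(T)` of arcs: over-arcs are not divided at crossings. -/
def Arc : Type :=
  Quot fun s t : T.SemiArc => ∃ c : T.Crossing, s = c.overSrc ∧ t = c.overTgt

variable {T} in
/-- The projection from semi-arcs to arcs. -/
def SemiArc.arc (s : T.SemiArc) : T.Arc := Quot.mk _ s

end Tangle

/-! ### Colorings -/

/-- The set `Col_X(T)` of biquandle colorings. -/
@[ext]
structure Coloring (X : Type u) [Biquandle X] {u v : List Bool} (T : Tangle u v) where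
  color : T.SemiArc → X
  under_eq : ∀ c : T.Crossing,
    Biquandle.ust (color c.underSrc) (color c.overSrc) = color c.underTgt
  over_eq : ∀ c : T.Crossing,
    Biquandle.ost (color c.overSrc) (color c.underSrc) = color c.overTgt

open Quandles in
/-- The set `Col_Q(T)` of quandle colorings. -/
@[ext]
structure QColoring (Q : Type u) [Quandle Q] {u v : List Bool} (T : Tangle u v) where
  color : T.Arc → Q
  act_eq : ∀ c : T.Crossing,
    color c.overSrc.arc ◃ color c.underSrc.arc = color c.underTgt.arc

/-- A quandle coloring by `Q(X)`, composed with the projection from semi-arcs to arcs, as a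
biquandle coloring by the biquandle `Q(X)`. -/
noncomputable def QColoring.toColoring {X : Type u} [Biquandle X] {u v : List Bool}
    {T : Tangle u v} (C : QColoring (Qdl X) T) : Coloring (Qdl X) T where
  color s := C.color s.arc
  under_eq := C.act_eq
  over_eq c := congrArg C.color (Quot.sound ⟨c, rfl, rfl⟩)

/-- The colors of the strings at level `j`, from left to right. -/
def Coloring.level {X : Type u} [Biquandle X] {u v : List Bool} {T : Tangle u v}
    (C : Coloring X T) (j : ℕ) : List X :=
  List.ofFn fun i : Fin (T.word j).length =>
    C.color (Tangle.Point.semiArc ⟨j, i.1, i.2⟩)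

/-! ### Regions, region colorings and shadow colorings -/

namespace Tangle

variable {u v : List Bool} (T : Tangle u v)

/-- The gaps between consecutive strings at the levels of the diagram; gap `pos` has exactly
`pos` strings to its left. -/
@[ext]
structure Gap where
  lvl : ℕ
  pos : ℕ
  lvl_le : lvl ≤ T.pieces.length
  pos_le : pos ≤ (T.word lvl).length

/-- Two gaps are joined inside one strip in the complement of the diagram. -/
def GapAdj (g h : T.Gap) : Prop :=
  ∃ (j : ℕ) (s : Piece), T.pieces[j]? = some s ∧
    g.lvl = j ∧ h.lvl = j + 1 ∧ s.GapThrough g.pos h.pos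

/-- The set `R(T)` of regions. -/
def Region : Type := Quot T.GapAdj

variable {T}

/-- The region containing a gap. -/
def Gap.region (g : T.Gap) : T.Region := Quot.mk _ g

/-- The unbounded region of a link diagram (for a tangle: the region of the upper left end). -/
def unbounded (T : Tangle u v) : T.Region :=
  Gap.region ⟨0, 0, Nat.zero_le _, Nat.zero_le _⟩

/-- The gaps on the left and on the right of a point. -/
def Point.leftGap (p : T.Point) : T.Gap := ⟨p.lvl, p.pos, p.lvl_le, p.pos_lt.le⟩
def Point.rightGap (p : T.Point) : T.Gap := ⟨p.lvl, p.pos + 1, p.lvl_le, p.pos_lt⟩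

/-- The gap from which the normal vector at a point emanates, and the one to which it points. -/
def Point.srcGap (p : T.Point) : T.Gap := if p.dir then p.leftGap else p.rightGap
def Point.tgtGap (p : T.Point) : T.Gap := if p.dir then p.rightGap else p.leftGap

theorem Point.getElem?_dir (p : T.Point) : (T.word p.lvl)[p.pos]? = some p.dir :=
  List.getElem?_eq_getElem p.pos_lt

theorem Gap.region_eq {g h : T.Gap} {j : ℕ} {s : Piece} (hs : T.pieces[j]? = some s)
    (hg : g.lvl = j) (hh : h.lvl = j + 1) (hgh : s.GapThrough g.pos h.pos) :
    g.region = h.region :=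
  Quot.sound ⟨j, s, hs, hg, hh, hgh⟩

theorem adj_regions {p q : T.Point} (h : T.Adj p q) :
    p.srcGap.region = q.srcGap.region ∧ p.tgtGap.region = q.tgtGap.region := by
  obtain ⟨j, s, hs, h⟩ := h
  have hj : j < T.pieces.length := (List.getElem?_eq_some_iff.1 hs).1
  have dp := p.getElem?_dir
  have dq := q.getElem?_dir
  rcases h with ⟨hp, hq, h⟩ | ⟨hp, hq, h⟩ | ⟨hp, hq, h⟩
  · rw [hp, word_top hs, h.getElem?] at dp
    rw [hq, word_bot hs, dp, Option.some.injEq] at dq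
    have e1 : p.leftGap.region = q.leftGap.region := Gap.region_eq hs hp hq h.gap.1
    have e2 : p.rightGap.region = q.rightGap.region := Gap.region_eq hs hp hq h.gap.2
    simp only [Point.srcGap, Point.tgtGap, dq]
    split <;> exact ⟨by assumption, by assumption⟩
  · cases s with
    | birth l r a =>
      obtain ⟨h1, h2⟩ := h
      rw [hp, word_bot hs, h1] at dp
      rw [hq, word_bot hs, h2] at dq
      simp [Piece.bot] at dp dq
      have dq' : q.dir = !a := by rw [dq, Bool.not_not]
      have e1 : p.rightGap = q.leftGap :=
        Gap.ext (hp.trans hq.symm) (by simp [Point.rightGap, Point.leftGap, h1, h2])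
      let g : T.Gap := ⟨j, l.length, hj.le, by rw [word_top hs]; simp [Piece.top]⟩
      have e2 : g.region = p.leftGap.region := Gap.region_eq hs rfl hp (Or.inl ⟨le_rfl, h1⟩)
      have e3 : g.region = q.rightGap.region :=
        Gap.region_eq hs rfl hq (Or.inr ⟨le_rfl, congrArg (· + 1) h2⟩)
      simp only [Point.srcGap, Point.tgtGap, ← dp, dq']
      cases a <;> simp [e1, ← e2, e3]
    | cross => exact h.elim
    | death => exact h.elim
  · cases s with
    | death l r a =>
      obtain ⟨h1, h2⟩ := h
      rw [hp, word_top hs, h1] at dp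
      rw [hq, word_top hs, h2] at dq
      simp [Piece.top] at dp dq
      have dq' : q.dir = !a := by rw [dq, Bool.not_not]
      have e1 : p.rightGap = q.leftGap :=
        Gap.ext (hp.trans hq.symm) (by simp [Point.rightGap, Point.leftGap, h1, h2])
      let g : T.Gap := ⟨j + 1, l.length, hj, by rw [word_bot hs]; simp [Piece.bot]⟩
      have e2 : p.leftGap.region = g.region := Gap.region_eq hs hp rfl (Or.inl ⟨le_rfl, h1⟩)
      have e3 : q.rightGap.region = g.region :=
        Gap.region_eq hs hq rfl (Or.inr ⟨le_rfl, congrArg (· + 1) h2⟩)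
      simp only [Point.srcGap, Point.tgtGap, ← dp, dq']
      cases a <;> simp [e1, e2, e3]
    | cross => exact h.elim
    | birth => exact h.elim

/-- The specified region of a semi-arc: its normal vector emanates from it. -/
def SemiArc.specified (s : T.SemiArc) : T.Region :=
  Quot.lift (fun p : T.Point => p.srcGap.region) (fun _ _ h => (adj_regions h).1) s

/-- The region to which the normal vector of a semi-arc points. -/
def SemiArc.opposite (s : T.SemiArc) : T.Region :=
  Quot.lift (fun p : T.Point => p.tgtGap.region) (fun _ _ h => (adj_regions h).2) s

end Tangle

section Shadow

variable {X : Type u} [Biquandle X] {u v : List Bool} {T : Tangle u v}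

/-- The contribution of the `i`-th string at level `j`: its color or the inverse, according to the
orientation of the string. -/
noncomputable def Coloring.sign (C : Coloring X T) (p : T.Point) : As X :=
  if p.dir then As.of (C.color p.semiArc) else (As.of (C.color p.semiArc))⁻¹

/-- The color of a gap: the product of the contributions of the strings to its left. -/
noncomputable def Coloring.gapColor (C : Coloring X T) (j : ℕ) : ℕ → As X
  | 0 => 1
  | i + 1 => C.gapColor j i *
      if h : i < (T.word j).length then C.sign ⟨j, i, h⟩ else 1

theorem Coloring.gapColor_succ (C : Coloring X T) (p : T.Point) :
    C.gapColor p.lvl (p.pos + 1) = C.gapColor p.lvl p.pos * C.sign p := by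
  show C.gapColor p.lvl p.pos * (if h : p.pos < (T.word p.lvl).length then
    C.sign ⟨p.lvl, p.pos, h⟩ else 1) = _
  rw [dif_pos p.pos_lt]

theorem Coloring.sign_through (C : Coloring X T) {p q : T.Point} {j : ℕ} {s : Piece}
    (hs : T.pieces[j]? = some s) (hp : p.lvl = j) (hq : q.lvl = j + 1)
    (h : s.Through p.pos q.pos) : C.sign p = C.sign q := by
  have e : p.semiArc = q.semiArc := Quot.sound ⟨j, s, hs, Or.inl ⟨hp, hq, h⟩⟩
  have dp := p.getElem?_dir
  have dq := q.getElem?_dir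
  rw [hp, Tangle.word_top hs, h.getElem?] at dp
  rw [hq, Tangle.word_bot hs, dp, Option.some.injEq] at dq
  rw [sign, sign, e, dq]

/-- Passing both strands of a crossing on its upper and on its lower side. -/
theorem Coloring.sign_crossing (C : Coloring X T) (c : T.Crossing) :
    C.sign c.topLeft * C.sign c.topRight = C.sign c.botLeft * C.sign c.botRight := by
  have h1 := C.under_eq c
  have h2 := C.over_eq c
  have rel : ∀ x y : X, As.of x * As.of (Biquandle.ost y x) =
    As.of y * As.of (Biquandle.ust x y) := As.rel
  have r := rel (C.color c.underSrc) (C.color c.overSrc)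
  rw [h1, h2] at r
  rw [sign, sign, sign, sign, c.topLeft_dir, c.topRight_dir, c.botLeft_dir, c.botRight_dir]
  simp only [Tangle.Crossing.underSrc, Tangle.Crossing.underTgt, Tangle.Crossing.overSrc,
    Tangle.Crossing.overTgt, Tangle.Crossing.srcA, Tangle.Crossing.tgtA,
    Tangle.Crossing.srcB, Tangle.Crossing.tgtB] at r
  rcases ha : c.a <;> rcases hb : c.b <;> rcases ho : c.o <;>
    simp only [ha, hb, ho, if_true, if_false, Bool.false_eq_true] at r ⊢
  all_goals
    first
    | exact r
    | exact r.symm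
    | (rw [← mul_inv_rev, ← mul_inv_rev, inv_inj]
       first | exact r | exact r.symm)
    | (rw [inv_mul_eq_iff_eq_mul, ← mul_assoc, eq_mul_inv_iff_mul_eq]
       first | exact r | exact r.symm)
    | (rw [mul_inv_eq_iff_eq_mul, mul_assoc, eq_inv_mul_iff_mul_eq]
       first | exact r | exact r.symm)

theorem Coloring.gapColor_add_one (C : Coloring X T) {j i : ℕ} (h : i < (T.word j).length) :
    C.gapColor j (i + 1) = C.gapColor j i * C.sign ⟨j, i, h⟩ :=
  C.gapColor_succ ⟨j, i, h⟩

theorem Coloring.gapColor_step (C : Coloring X T) {j i k : ℕ} {s : Piece}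
    (hs : T.pieces[j]? = some s) (hi : i < (T.word j).length) (hk : k < (T.word (j + 1)).length)
    (h : s.Through i k) (e : C.gapColor j i = C.gapColor (j + 1) k) :
    C.gapColor j (i + 1) = C.gapColor (j + 1) (k + 1) := by
  rw [C.gapColor_add_one hi, C.gapColor_add_one hk, e]
  congr 1
  exact C.sign_through hs rfl rfl h

theorem Coloring.gapColor_turn (C : Coloring X T) {j i : ℕ} {a : Bool}
    (h0 : (T.word j)[i]? = some a) (h1 : (T.word j)[i + 1]? = some (!a))
    (h : ∀ p q : T.Point, p.lvl = j → p.pos = i → q.lvl = j → q.pos = i + 1 →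
      T.Adj p q) : C.gapColor j (i + 2) = C.gapColor j i := by
  obtain ⟨hi, h0⟩ := List.getElem?_eq_some_iff.1 h0
  obtain ⟨hi', h1⟩ := List.getElem?_eq_some_iff.1 h1
  have e : Tangle.Point.semiArc (⟨j, i, hi⟩ : T.Point) =
      Tangle.Point.semiArc (⟨j, i + 1, hi'⟩ : T.Point) := Quot.sound (h _ _ rfl rfl rfl rfl)
  rw [C.gapColor_add_one hi', C.gapColor_add_one hi, sign, sign, e, mul_assoc]
  have d0 : Tangle.Point.dir (⟨j, i, hi⟩ : T.Point) = a := h0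
  have d1 : Tangle.Point.dir (⟨j, i + 1, hi'⟩ : T.Point) = !a := h1
  rw [d0, d1]
  cases a <;> simp

theorem Coloring.gapColor_adj (C : Coloring X T) {g h : T.Gap} (hgh : T.GapAdj g h) :
    C.gapColor g.lvl g.pos = C.gapColor h.lvl h.pos := by
  obtain ⟨j, s, hs, hg, hh, hgh⟩ := hgh
  obtain ⟨gl, i, hgl, hi⟩ := g
  obtain ⟨hl, k, hhl, hk⟩ := h
  dsimp only at hg hh hgh hi hk ⊢
  subst hg hh
  have wt := Tangle.word_top hs
  have wb := Tangle.word_bot hs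
  cases s with
  | cross l r a b o =>
    obtain ⟨rfl, hne⟩ := hgh
    have lt : (T.word gl).length = l.length + r.length + 2 := by
      rw [wt]; simp [Piece.top]; omega
    have lb : (T.word (gl + 1)).length = l.length + r.length + 2 := by
      rw [wb]; simp [Piece.bot]; omega
    induction i using Nat.strong_induction_on with
    | _ i ih =>
      rcases i with _ | i
      · rfl
      · rcases eq_or_ne i (l.length + 1) with rfl | h1
        · have e := ih l.length (by omega) (by omega) (by omega) (by omega)
          have c := C.sign_crossing ⟨gl, l, r, a, b, o, hs⟩
          rw [C.gapColor_add_one (by omega), C.gapColor_add_one (by omega),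
            C.gapColor_add_one (by omega), C.gapColor_add_one (by omega), e, mul_assoc,
            mul_assoc]
          exact congrArg _ c
        · exact C.gapColor_step hs (by omega) (by omega) ⟨rfl, by omega, h1⟩
            (ih i (by omega) (by omega) h1 (by omega))
  | birth l r a =>
    have lt : (T.word gl).length = l.length + r.length := by
      rw [wt]; simp [Piece.top]
    have lb : (T.word (gl + 1)).length = l.length + r.length + 2 := by
      rw [wb]; simp [Piece.bot]; omega
    have left : ∀ m ≤ l.length, C.gapColor gl m = C.gapColor (gl + 1) m := by
      intro m hm
      induction m with
      | zero => rfl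
      | succ m ih =>
        exact C.gapColor_step hs (by omega) (by omega) (Or.inl ⟨by omega, rfl⟩) (ih (by omega))
    have turn : C.gapColor (gl + 1) (l.length + 2) = C.gapColor (gl + 1) l.length := by
      refine C.gapColor_turn (a := a) (by rw [wb]; simp [Piece.bot])
        (by rw [wb]; simp [Piece.bot]) ?_
      intro p q h1 h2 h3 h4
      exact ⟨gl, _, hs, Or.inr (Or.inl ⟨h1, h3, h2, h4⟩)⟩
    have right : ∀ m, m ≤ r.length →
        C.gapColor gl (l.length + m) = C.gapColor (gl + 1) (l.length + m + 2) := by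
      intro m hm
      induction m with
      | zero => exact (left _ le_rfl).trans turn.symm
      | succ m ih =>
        exact C.gapColor_step (i := l.length + m) (k := l.length + m + 2) hs (by omega) (by omega)
          (Or.inr ⟨by omega, rfl⟩) (ih (by omega))
    rcases hgh with ⟨h1, rfl⟩ | ⟨h1, rfl⟩
    · exact left _ h1
    · obtain ⟨m, rfl⟩ := Nat.exists_eq_add_of_le h1
      exact right m (by omega)
  | death l r a =>
    have lt : (T.word gl).length = l.length + r.length + 2 := by
      rw [wt]; simp [Piece.top]; omega
    have lb : (T.word (gl + 1)).length = l.length + r.length := by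
      rw [wb]; simp [Piece.bot]
    have left : ∀ m ≤ l.length, C.gapColor gl m = C.gapColor (gl + 1) m := by
      intro m hm
      induction m with
      | zero => rfl
      | succ m ih =>
        exact C.gapColor_step hs (by omega) (by omega) (Or.inl ⟨by omega, rfl⟩) (ih (by omega))
    have turn : C.gapColor gl (l.length + 2) = C.gapColor gl l.length := by
      refine C.gapColor_turn (a := a) (by rw [wt]; simp [Piece.top])
        (by rw [wt]; simp [Piece.top]) ?_
      intro p q h1 h2 h3 h4
      exact ⟨gl, _, hs, Or.inr (Or.inr ⟨h1, h3, h2, h4⟩)⟩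
    have right : ∀ m, m ≤ r.length →
        C.gapColor gl (l.length + m + 2) = C.gapColor (gl + 1) (l.length + m) := by
      intro m hm
      induction m with
      | zero => exact turn.trans (left _ le_rfl)
      | succ m ih =>
        exact C.gapColor_step (i := l.length + m + 2) (k := l.length + m) hs (by omega) (by omega)
          (Or.inr ⟨by omega, rfl⟩) (ih (by omega))
    rcases hgh with ⟨h1, rfl⟩ | ⟨h1, rfl⟩
    · exact left _ h1
    · obtain ⟨m, rfl⟩ := Nat.exists_eq_add_of_le h1
      exact right m (by omega)

/-- The region coloring with respect to `C`. -/
noncomputable def Coloring.regionColor (C : Coloring X T) (R : T.Region) : As X :=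
  Quot.lift (fun g : T.Gap => C.gapColor g.lvl g.pos) (fun _ _ h => C.gapColor_adj h) R

/-- The two conditions that characterize the region coloring. -/
def Coloring.IsRegionColoring (C : Coloring X T) (ρ : T.Region → As X) : Prop :=
  ρ T.unbounded = 1 ∧
    ∀ s : T.SemiArc, ρ s.specified * As.of (C.color s) = ρ s.opposite

theorem Coloring.regionColor_isRegionColoring (C : Coloring X T) :
    C.IsRegionColoring C.regionColor := by
  refine ⟨rfl, ?_⟩
  rintro ⟨p⟩
  have h := C.gapColor_succ p
  show C.gapColor p.srcGap.lvl p.srcGap.pos * As.of (C.color p.semiArc)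
    = C.gapColor p.tgtGap.lvl p.tgtGap.pos
  rw [sign] at h
  cases hd : p.dir <;>
    simp only [hd, if_true, if_false, Bool.false_eq_true, Tangle.Point.srcGap,
      Tangle.Point.tgtGap, Tangle.Point.leftGap, Tangle.Point.rightGap] at h ⊢ <;>
    rw [h]
  simp

/-- The region coloring of a link diagram is the only map with the two properties. -/
theorem Coloring.IsRegionColoring.eq {D : LinkDiagram} {C : Coloring X D} {ρ : D.Region → As X}
    (h : C.IsRegionColoring ρ) : ρ = C.regionColor := by
  have h' := C.regionColor_isRegionColoring
  have left : ∀ j (hj : j ≤ D.pieces.length),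
      D.unbounded = Tangle.Gap.region ⟨j, 0, hj, Nat.zero_le _⟩ := by
    intro j
    induction j with
    | zero => intro _; rfl
    | succ j ih =>
      intro hj
      rw [ih (by omega)]
      refine Tangle.Gap.region_eq (List.getElem?_eq_getElem (i := j) (by omega)) rfl rfl ?_
      cases D.pieces[j] <;> simp [Piece.GapThrough]
  funext R
  obtain ⟨j, i, hj, hi⟩ := R
  induction i with
  | zero =>
    have e := left j hj
    exact (congrArg ρ e.symm).trans (h.1.trans (h'.1.symm.trans (congrArg _ e)))
  | succ i ih =>
    have e := ih (by omega)
    let p : D.Point := ⟨j, i, hi⟩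
    have e : ρ p.leftGap.region = C.regionColor p.leftGap.region := e
    show ρ p.rightGap.region = C.regionColor p.rightGap.region
    have h2 : ρ p.srcGap.region * _ = ρ p.tgtGap.region := h.2 p.semiArc
    have h3 : C.regionColor p.srcGap.region * _ = C.regionColor p.tgtGap.region :=
      h'.2 p.semiArc
    cases hd : p.dir <;>
      simp only [hd, if_true, if_false, Bool.false_eq_true, Tangle.Point.srcGap,
        Tangle.Point.tgtGap] at h2 h3
    · rw [e, ← h3] at h2
      exact mul_right_cancel h2
    · rw [← h2, ← h3, e]

/-- The shadow coloring with respect to `C`. -/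
noncomputable def Coloring.shadow (C : Coloring X T) (s : T.SemiArc) : As X × X :=
  (C.regionColor s.specified, C.color s)

end Shadow

/-! ### The doubled diagram and the pulling away map -/

/-- Orientations of the strings of the doubled diagram `W(D)` at a level where `D` has strings
`u`.  A string of `D` and its parallel copy in `-D^v`, which has the opposite orientation and is
shifted into the direction of the normal vector, form a pair of which the left string is directed
downwards and the right string upwards: the string of `D` is the left one of the pair iff it is
directed downwards. -/
def dbl (u : List Bool) : List Bool := u.flatMap fun _ => [true, false]

/-- The crossing information in `W(D)` at a crossing of two strings `A`, `B`, where `mainA`,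
`mainB` tell whether the string belongs to `D` (and not to `-D^v`), and `o` tells whether `A` is
the over-strand at the original crossing of `D`: it is kept for two strings of `D` and reversed for
two strings of `-D^v`, and strings of `D` are over those of `-D^v`. -/
def dblOver (o mainA mainB : Bool) : Bool :=
  if mainA = mainB then (if mainA then o else !o) else mainA

/-- The part of the doubled diagram originating from one strip. -/
def Piece.double : Piece → List Piece
  | .cross l r a b o =>
    [.cross (dbl l ++ [true]) (false :: dbl r) false true (dblOver o (!a) b),
     .cross (dbl l) (false :: false :: dbl r) true true (dblOver o a b),
     .cross (dbl l ++ [true, true]) (dbl r) false false (dblOver o (!a) (!b)),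
     .cross (dbl l ++ [true]) (false :: dbl r) true false (dblOver o a (!b))]
  | .birth l r _ =>
    [.birth (dbl l) (dbl r) true, .birth (dbl l ++ [true]) (false :: dbl r) false]
  | .death l r _ =>
    [.death (dbl l ++ [true]) (false :: dbl r) false, .death (dbl l) (dbl r) true]

theorem dbl_append (u v : List Bool) : dbl (u ++ v) = dbl u ++ dbl v := by
  simp [dbl]

theorem Piece.runs_double (s : Piece) : Runs (dbl s.top) s.double (dbl s.bot) := by
  cases s <;> simp [Piece.double, Runs, Piece.top, Piece.bot, dbl]

theorem Runs.double {u v : List Bool} {ps : List Piece} (h : Runs u ps v) :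
    Runs (dbl u) (ps.flatMap Piece.double) (dbl v) := by
  induction ps generalizing u with
  | nil => cases h; rfl
  | cons p ps ih =>
    obtain ⟨rfl, h⟩ := h
    rw [List.flatMap_cons]
    exact p.runs_double.append (ih h)

/-- The doubled diagram `W(D)`. -/
def LinkDiagram.doubled (D : LinkDiagram) : LinkDiagram :=
  ⟨D.pieces.flatMap Piece.double, D.runs.double⟩

/-- The level of `W(D)` that is the double of level `j` of `D`. -/
def LinkDiagram.doubledLevel (D : LinkDiagram) (j : ℕ) : ℕ :=
  ((D.pieces.take j).flatMap Piece.double).length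

/-- A string of orientation `d`, with strings `x` to its left, is moved to the right behind the
strings `w`. -/
def slideBehind (x : List Bool) (d : Bool) : List Bool → List Piece
  | [] => []
  | b :: w => .cross x w d b false :: slideBehind (x ++ [b]) d w

theorem runs_slideBehind (x : List Bool) (d : Bool) (w : List Bool) :
    Runs (x ++ d :: w) (slideBehind x d w) (x ++ w ++ [d]) := by
  induction w generalizing x with
  | nil => simp [slideBehind, Runs]
  | cons b w ih =>
    refine ⟨rfl, ?_⟩
    have := ih (x ++ [b])
    simpa [Piece.bot] using this

/-- Pulling away the strings of `-D^v` from a doubled trivial tangle: the leftmost string of `-D^v`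
is moved behind all the others to the right end, then the second one to the left of the first, and
so on. -/
def pullPieces : List Bool → List Piece
  | [] => []
  | d :: u =>
    (if d then slideBehind [true] false (dbl u) else slideBehind [] true (false :: dbl u)) ++
      (pullPieces u).map (Piece.shift [d] [!d])

/-- Orientations of the strings of `D ⊔ -D^h` at a level where `D` has strings `u`. -/
def mirrored (u : List Bool) : List Bool := u ++ (u.map not).reverse

theorem runs_pullPieces (u : List Bool) : Runs (dbl u) (pullPieces u) (mirrored u) := by
  induction u with
  | nil => rfl
  | cons d u ih =>
    have h := ih.shift [d] [!d]
    have e : [d] ++ mirrored u ++ [!d] = mirrored (d :: u) := by simp [mirrored]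
    rw [e] at h
    refine Runs.append ?_ h
    cases d
    · exact runs_slideBehind [] true (false :: dbl u)
    · exact runs_slideBehind [true] false (dbl u)

/-- The doubled trivial tangle with strings `u`, after the strings of `-D^v` have been pulled away
in the middle part of the strip by Reidemeister moves of type II: the pulling is followed by its
inverse.  The level in the middle is `(pullPieces u).length`. -/
def pulledStrip (u : List Bool) : Tangle (dbl u) (dbl u) :=
  ⟨pullPieces u ++ ((pullPieces u).map Piece.flip).reverse,
    (runs_pullPieces u).append (runs_pullPieces u).flip⟩

section PullAway

variable {X : Type u} [Biquandle X] {D : LinkDiagram}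

/-- `E` is the coloring of `W(D)` that corresponds to the quandle coloring `C` of `D`: away from
the crossings of `D`, both strings of a pair receive the color that `C` assigns to the string of
`D`. -/
def IsDoubling (C : QColoring (Qdl X) D) (E : Coloring X D.doubled) : Prop :=
  ∀ j ≤ D.pieces.length,
    E.level (D.doubledLevel j) = (C.toColoring.level j).flatMap fun a => [a.out, a.out]

/-- `C'` is read off from a coloring `E` of `W(D)` after pulling away `-D^v`: at each level of `D`,
the doubled trivial tangle is replaced by `pulledStrip`, the coloring being unchanged outside of
it, and in the middle of the new strip the strings on the left, which are those of `D`, have the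
colors prescribed by `C'`. -/
def IsPulledAway (E : Coloring X D.doubled) (C' : Coloring X D) : Prop :=
  ∀ j ≤ D.pieces.length, ∃ F : Coloring X (pulledStrip (D.word j)),
    F.level 0 = E.level (D.doubledLevel j) ∧
    F.level (pulledStrip (D.word j)).pieces.length = E.level (D.doubledLevel j) ∧
    (F.level (pullPieces (D.word j)).length).take (D.word j).length = C'.level j

/-- `Ψ` is the pulling away map from `Q(X)`-colorings to `X`-colorings of `D`: take the doubled
coloring of `W(D)`, pull away `-D^v`, and restrict the coloring to `D`. -/
def IsPullingAwayMap (Ψ : QColoring (Qdl X) D → Coloring X D) : Prop :=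
  ∀ C C', C' = Ψ C ↔ ∃ E : Coloring X D.doubled, IsDoubling C E ∧ IsPulledAway E C'

end PullAway

end KnotColor

/-!
The group `As(X)` acts on `X` from the right through the operations `· overline-star x`, and it acts
by automorphisms of the quandle `Q(X)`. The map `ψ(p, ·)` is the action of `ψ_As(p)`. At a crossing
the regions behind the two source semi-arcs agree, and the regions behind the target semi-arcs arise
from it by passing one of the strands, so the axioms of a `Q(X)`-coloring `C` turn into those of an
`X`-coloring `ψ ∘ C^S`. Its region coloring is the image of that of `C` under `ψ_As`, and letting
the inverses of the region colors of an `X`-coloring act on its colors recovers `C`.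

When the leftmost string of `-D^v`, of color `z`, is moved behind the other strings, each of them is
acted on by `z` or its inverse, and this is what passing the corresponding string of `D` does to the
color of a region. Hence a string of `D` ends up with the color `ψ(p, a)`, where `(p, a)` is its
shadow color. The colors below a crossing are determined by those above it, so no other coloring can
result from the pulling.
-/

namespace KnotColor

/-! ### The action of the associated group -/

section Action

open Quandles

variable {X : Type u} [Biquandle X]

/-- The right action of `As(X)` on `X` in which the generator `x` acts by `· overline-star x`. -/
noncomputable def overAct (X : Type u) [Biquandle X] : As X →* (Equiv.Perm X)ᵐᵒᵖ :=
  PresentedGroup.toGroup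
    (f := fun x : X => MulOpposite.op (Equiv.ofBijective _ (Biquandle.over_bij x))) (by
    rintro _ ⟨x, y, rfl⟩
    simp only [map_mul, map_inv, FreeGroup.lift_apply_of]
    rw [mul_inv_eq_one]
    apply MulOpposite.unop_injective
    ext1 z
    exact Biquandle.over_over z x y)

/-- The permutation of `X` by which an element of `As(X)` acts from the right. -/
noncomputable def overPerm (g : As X) : Equiv.Perm X := (overAct X g).unop

theorem overPerm_one (a : X) : overPerm (1 : As X) a = a := by simp [overPerm]

theorem overPerm_mul_of (g : As X) (x a : X) :
    overPerm (g * As.of x) a = Biquandle.ost (overPerm g a) x := by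
  simp [overPerm, overAct, As.of]

theorem overPerm_mul_of_inv (g : As X) (x a : X) :
    overPerm (g * (As.of x)⁻¹) a = overInv (overPerm g a) x := by
  apply over_cancel x
  rw [← overPerm_mul_of, inv_mul_cancel_right, over_overInv]

theorem As.induction_on {P : As X → Prop} (g : As X) (one : P 1)
    (mul_of : ∀ g x, P g → P (g * As.of x))
    (mul_of_inv : ∀ g x, P g → P (g * (As.of x)⁻¹)) : P g := by
  have hg : g ∈ Subgroup.closure (Set.range (As.of : X → As X)) :=
    PresentedGroup.closure_range_of (asRels X) ▸ Subgroup.mem_top g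
  induction hg using Subgroup.closure_induction_right with
  | one => exact one
  | mul_right g _ _ hx ih =>
    obtain ⟨x, rfl⟩ := hx
    exact mul_of g x ih
  | mul_inv_cancel g _ _ hx ih =>
    obtain ⟨x, rfl⟩ := hx
    exact mul_of_inv g x ih

theorem overPerm_qop (g : As X) (a b : X) :
    overPerm g (qop a b) = qop (overPerm g a) (overPerm g b) := by
  induction g using As.induction_on with
  | one => simp only [overPerm_one]
  | mul_of g x ih => simp only [overPerm_mul_of, ih, over_qop_distrib]
  | mul_of_inv g x ih => simp only [overPerm_mul_of_inv, ih, overInv_qop_distrib]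

theorem overInv_kMap_self (x : X) : overInv x (kMap x) = kMap x := by
  apply over_cancel (kMap x)
  rw [over_overInv, over_kMap]

theorem psi_mul_of_inv_self (p : As (Qdl X)) (a : Qdl X) :
    psi (p * (As.of a)⁻¹) a = kMap (psi p a) := by
  rw [psi_mul_of_inv, overInv_kMap_self]

theorem psi_act (p : As (Qdl X)) (a b : Qdl X) : psi p (b ◃ a) = qop (psi p a) (psi p b) :=
  (psiPair p).2.2 a b

theorem psi_eq_overPerm (p : As (Qdl X)) (a : Qdl X) : psi p a = overPerm (psiAs p) a.out := by
  induction p using As.induction_on generalizing a with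
  | one => rw [psi_one, psiAs_one, overPerm_one]
  | mul_of p x ih => rw [psi_mul_of, psiAs_mul_of, overPerm_mul_of, ih a]
  | mul_of_inv p x ih =>
    rw [psiAs_mul_of_inv, psi_mul_of_inv_self, overPerm_mul_of_inv, psi_mul_of_inv, ih a]

theorem mul_of_overPerm_injective (a : X) :
    Function.Injective fun g : As X => g * As.of (overPerm g a) := by
  have retraction : Function.LeftInverse (fun h : As X => h * (As.of (kMap (overPerm h a)))⁻¹)
      fun g => g * As.of (overPerm g a) := fun g => by
    simp only [overPerm_mul_of, kMap_over, mul_inv_cancel_right]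
  exact retraction.injective

theorem psiAs_mul_of_eq_iff (p : As (Qdl X)) (g : As X) (a : Qdl X) :
    psiAs (p * As.of a) = g * As.of (overPerm g a.out) ↔ psiAs p = g := by
  rw [psiAs_mul_of, psi_eq_overPerm]
  exact (mul_of_overPerm_injective a.out).eq_iff

end Action

/-! ### Regions and semi-arcs -/

namespace Tangle

variable {u v : List Bool} {T : Tangle u v}

theorem Gap.region_leftmost (T : Tangle u v) {j : ℕ} (hj : j ≤ T.pieces.length) :
    Gap.region (T := T) ⟨j, 0, hj, Nat.zero_le _⟩ = T.unbounded := by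
  induction j with
  | zero => rfl
  | succ j ih =>
    rw [← ih (by omega)]
    refine (Gap.region_eq (List.getElem?_eq_getElem (i := j) (by omega)) rfl rfl ?_).symm
    cases T.pieces[j] <;> simp [Piece.GapThrough]

theorem Region.induction_on {P : T.Region → Prop} (R : T.Region) (unbounded : P T.unbounded)
    (specified_iff_opposite : ∀ s : T.SemiArc, P s.specified ↔ P s.opposite) : P R := by
  obtain ⟨j, i, hj, hi⟩ := R
  induction i with
  | zero => exact (congrArg P (Gap.region_leftmost T hj)).mpr unbounded
  | succ i ih =>
    let p : T.Point := ⟨j, i, hi⟩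
    have left : P p.leftGap.region := ih (by omega)
    have sides : P p.srcGap.region ↔ P p.tgtGap.region := specified_iff_opposite p.semiArc
    rw [Point.srcGap, Point.tgtGap] at sides
    change P p.rightGap.region
    cases hd : p.dir <;> simp only [hd, Bool.false_eq_true, if_true, if_false] at sides
    · exact sides.2 left
    · exact sides.1 left

namespace Crossing

variable (c : T.Crossing)

theorem region_left : c.topLeft.leftGap.region = c.botLeft.leftGap.region :=
  Gap.region_eq c.get_eq rfl rfl ⟨rfl, by simp [topLeft, Point.leftGap]⟩

theorem region_right : c.topRight.rightGap.region = c.botRight.rightGap.region :=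
  Gap.region_eq c.get_eq rfl rfl ⟨rfl, by simp [topRight, Point.rightGap]⟩

theorem region_top : c.topLeft.rightGap.region = c.topRight.leftGap.region := rfl

theorem region_bot : c.botLeft.rightGap.region = c.botRight.leftGap.region := rfl

theorem specified_srcB : c.srcB.specified = c.srcA.specified := by
  have spec (p : T.Point) : p.semiArc.specified = p.srcGap.region := rfl
  cases ha : c.a <;> cases hb : c.b <;>
    simp [srcA, srcB, spec, Point.srcGap, topLeft_dir, topRight_dir, botLeft_dir, botRight_dir,
      ha, hb, region_left, region_right, region_top, region_bot]

theorem specified_tgtA : c.tgtA.specified = c.srcB.opposite := by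
  have spec (p : T.Point) : p.semiArc.specified = p.srcGap.region := rfl
  have opp (p : T.Point) : p.semiArc.opposite = p.tgtGap.region := rfl
  cases ha : c.a <;> cases hb : c.b <;>
    simp [tgtA, srcB, spec, opp, Point.srcGap, Point.tgtGap, topLeft_dir, topRight_dir,
      botLeft_dir, botRight_dir, ha, hb, region_left, region_right, region_top, region_bot]

theorem specified_tgtB : c.tgtB.specified = c.srcA.opposite := by
  have spec (p : T.Point) : p.semiArc.specified = p.srcGap.region := rfl
  have opp (p : T.Point) : p.semiArc.opposite = p.tgtGap.region := rfl
  cases ha : c.a <;> cases hb : c.b <;>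
    simp [tgtB, srcA, spec, opp, Point.srcGap, Point.tgtGap, topLeft_dir, topRight_dir,
      botLeft_dir, botRight_dir, ha, hb, region_left, region_right, region_top, region_bot]

theorem specified_overSrc : c.overSrc.specified = c.underSrc.specified := by
  rw [overSrc, underSrc]
  split
  exacts [c.specified_srcB.symm, c.specified_srcB]

theorem specified_underTgt : c.underTgt.specified = c.overSrc.opposite := by
  rw [underTgt, overSrc]
  split
  exacts [c.specified_tgtB, c.specified_tgtA]

theorem specified_overTgt : c.overTgt.specified = c.underSrc.opposite := by
  rw [overTgt, underSrc]
  split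
  exacts [c.specified_tgtA, c.specified_tgtB]

end Crossing

end Tangle

/-! ### The bijection between the sets of colorings -/

section Bijection

open Quandles

variable {X : Type u} [Biquandle X] {u v : List Bool} {T : Tangle u v}

theorem Coloring.regionColor_unbounded (C : Coloring X T) : C.regionColor T.unbounded = 1 :=
  C.regionColor_isRegionColoring.1

theorem Coloring.regionColor_opposite (C : Coloring X T) (s : T.SemiArc) :
    C.regionColor s.opposite = C.regionColor s.specified * As.of (C.color s) :=
  (C.regionColor_isRegionColoring.2 s).symm

/-- The `X`-coloring `ψ ∘ C^S` obtained from a `Q(X)`-coloring `C`. -/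
noncomputable def QColoring.psiColoring (C : QColoring (Qdl X) T) : Coloring X T where
  color s := psi (C.toColoring.regionColor s.specified) (C.toColoring.color s)
  under_eq c := by
    have act : C.toColoring.color c.overSrc ◃ C.toColoring.color c.underSrc =
      C.toColoring.color c.underTgt := C.act_eq c
    rw [c.specified_underTgt, C.toColoring.regionColor_opposite, c.specified_overSrc, ← act,
      psi_mul_of, psi_act, over_qop]
  over_eq c := by
    have color_over : C.toColoring.color c.overSrc = C.toColoring.color c.overTgt :=
      C.toColoring.over_eq c
    rw [c.specified_overTgt, C.toColoring.regionColor_opposite, c.specified_overSrc,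
      ← color_over, psi_mul_of]

theorem QColoring.psiColoring_color (C : QColoring (Qdl X) T) (s : T.SemiArc) :
    C.psiColoring.color s = psi (C.toColoring.regionColor s.specified) (C.toColoring.color s) :=
  rfl

theorem QColoring.regionColor_psiColoring (C : QColoring (Qdl X) T) (R : T.Region) :
    C.psiColoring.regionColor R = psiAs (C.toColoring.regionColor R) := by
  induction R using Tangle.Region.induction_on with
  | unbounded => rw [Coloring.regionColor_unbounded, Coloring.regionColor_unbounded, psiAs_one]
  | specified_iff_opposite s =>
    rw [Coloring.regionColor_opposite, Coloring.regionColor_opposite, psiAs_mul_of,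
      C.psiColoring_color, mul_left_inj]

theorem QColoring.shadow_psiColoring (C : QColoring (Qdl X) T) :
    C.psiColoring.shadow = psiTilde ∘ C.toColoring.shadow :=
  funext fun s => Prod.ext (C.regionColor_psiColoring s.specified) rfl

/-- The `Q(X)`-coloring obtained from an `X`-coloring by letting the inverses of the region colors
act on the colors. -/
noncomputable def Coloring.unpsi (C : Coloring X T) : QColoring (Qdl X) T where
  color := Quot.lift
    (fun s => ((overPerm (C.regionColor s.specified)).symm (C.color s) : X)) (by
      rintro _ _ ⟨c, rfl, rfl⟩
      refine ((Equiv.symm_apply_eq (overPerm (C.regionColor c.overTgt.specified))).2 ?_).symm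
      rw [c.specified_overTgt, C.regionColor_opposite, c.specified_overSrc, overPerm_mul_of,
        Equiv.apply_symm_apply, C.over_eq])
  act_eq c := by
    change qop ((overPerm (C.regionColor c.underSrc.specified)).symm (C.color c.underSrc))
      ((overPerm (C.regionColor c.overSrc.specified)).symm (C.color c.overSrc)) =
      (overPerm (C.regionColor c.underTgt.specified)).symm (C.color c.underTgt)
    rw [Equiv.eq_symm_apply, c.specified_underTgt, C.regionColor_opposite, c.specified_overSrc,
      overPerm_mul_of, overPerm_qop, Equiv.apply_symm_apply, Equiv.apply_symm_apply, over_qop,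
      C.under_eq]

theorem Coloring.overPerm_unpsi_color (C : Coloring X T) (s : T.SemiArc) :
    overPerm (C.regionColor s.specified) (C.unpsi.toColoring.color s).out = C.color s :=
  Equiv.apply_symm_apply _ _

theorem Coloring.psiAs_regionColor_unpsi (C : Coloring X T) (R : T.Region) :
    psiAs (C.unpsi.toColoring.regionColor R) = C.regionColor R := by
  induction R using Tangle.Region.induction_on with
  | unbounded => rw [regionColor_unbounded, regionColor_unbounded, psiAs_one]
  | specified_iff_opposite s =>
    rw [regionColor_opposite, regionColor_opposite, ← C.overPerm_unpsi_color s,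
      psiAs_mul_of_eq_iff]

theorem Coloring.psiColoring_unpsi (C : Coloring X T) : C.unpsi.psiColoring = C := by
  ext s
  rw [QColoring.psiColoring_color, psi_eq_overPerm, C.psiAs_regionColor_unpsi,
    C.overPerm_unpsi_color]

theorem QColoring.unpsi_psiColoring (C : QColoring (Qdl X) T) : C.psiColoring.unpsi = C := by
  ext ⟨s⟩
  refine (Equiv.symm_apply_eq (overPerm (C.psiColoring.regionColor s.specified))).2 ?_
  rw [C.regionColor_psiColoring, C.psiColoring_color, psi_eq_overPerm]
  rfl

/-- The bijection `C ↦ ψ ∘ C^S` from `Q(X)`-colorings to `X`-colorings. -/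
noncomputable def psiColoringEquiv (X : Type u) [Biquandle X] (T : Tangle u v) :
    QColoring (Qdl X) T ≃ Coloring X T where
  toFun := QColoring.psiColoring
  invFun := Coloring.unpsi
  left_inv := QColoring.unpsi_psiColoring
  right_inv := Coloring.psiColoring_unpsi

end Bijection

/-! ### Colorings by levels -/

section CrossingColored

variable {X : Type u} [Biquandle X]

/-- The coloring condition at a crossing: `x` and `x'` are the colors of the source and the target
of the under-strand, `y` and `y'` those of the over-strand. -/
def CrossingRule (x y x' y' : X) : Prop :=
  Biquandle.ust x y = x' ∧ Biquandle.ost y x = y'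

namespace CrossingRule

variable {x y x' y' z w z' w' : X}

theorem tgt_unique (h : CrossingRule x y x' y') (h' : CrossingRule x y z' w') :
    x' = z' ∧ y' = w' :=
  ⟨h.1.symm.trans h'.1, h.2.symm.trans h'.2⟩

theorem src_unique (h : CrossingRule x y x' y') (h' : CrossingRule z w x' y') :
    x = z ∧ y = w := by
  have e : ((x, y) : X × X) = (z, w) := Biquandle.switch_bij.injective
    (Prod.ext (h.2.trans h'.2.symm) (h.1.trans h'.1.symm))
  exact Prod.ext_iff.1 e

theorem overSrc_underTgt_unique (h : CrossingRule x y x' y') (h' : CrossingRule x w z' y') :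
    y = w ∧ x' = z' := by
  obtain rfl : y = w := over_cancel x (h.2.trans h'.2.symm)
  exact ⟨rfl, h.1.symm.trans h'.1⟩

theorem underSrc_overTgt_unique (h : CrossingRule x y x' y') (h' : CrossingRule z y x' w') :
    x = z ∧ y' = w' := by
  obtain rfl : x = z := under_cancel y (h.1.trans h'.1.symm)
  exact ⟨rfl, h.2.symm.trans h'.2⟩

end CrossingRule

/-- The coloring condition at a crossing of strands `A` and `B` as in `Piece.cross`, for the colors
`p`, `q` of the upper ends and `p'`, `q'` of the lower ends, from left to right. -/
def CrossingColored (a b o : Bool) (p q p' q' : X) : Prop :=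
  let srcA := if b then p else q'
  let tgtA := if b then q' else p
  let srcB := if a then p' else q
  let tgtB := if a then q else p'
  if o then CrossingRule srcB srcA tgtB tgtA else CrossingRule srcA srcB tgtA tgtB

variable {a b o : Bool} {p q p' q' p'' q'' : X}

theorem CrossingColored.flip (h : CrossingColored a b o p q p' q') :
    CrossingColored b a (!o) p' q' p q := by
  cases o <;> exact h

theorem CrossingColored.bot_unique (h : CrossingColored a b o p q p' q')
    (h' : CrossingColored a b o p q p'' q'') : p' = p'' ∧ q' = q'' := by
  cases o <;> cases a <;> cases b
  · exact (h.underSrc_overTgt_unique h').symm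
  · exact (h.tgt_unique h').symm
  · exact (h.src_unique h').symm
  · exact h.overSrc_underTgt_unique h'
  · exact (h.overSrc_underTgt_unique h').symm
  · exact h.tgt_unique h'
  · exact h.src_unique h'
  · exact h.underSrc_overTgt_unique h'

theorem crossingColored_iff {u v : List Bool} {T : Tangle u v} (c : T.Crossing)
    (f : T.SemiArc → X) :
    CrossingColored c.a c.b c.o (f c.topLeft.semiArc) (f c.topRight.semiArc)
        (f c.botLeft.semiArc) (f c.botRight.semiArc) ↔
      CrossingRule (f c.underSrc) (f c.overSrc) (f c.underTgt) (f c.overTgt) := by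
  simp only [CrossingColored, Tangle.Crossing.underSrc, Tangle.Crossing.underTgt,
    Tangle.Crossing.overSrc, Tangle.Crossing.overTgt, Tangle.Crossing.srcA,
    Tangle.Crossing.tgtA, Tangle.Crossing.srcB, Tangle.Crossing.tgtB]
  cases c.a <;> cases c.b <;> cases c.o <;> rfl

end CrossingColored

section PieceColored

variable {X : Type u} [Biquandle X]

/-- `s.Colored w w'`: a coloring of the strip `s` exists in which the strings on the upper side
have the colors `w` and those on the lower side the colors `w'`. -/
inductive Piece.Colored : Piece → List X → List X → Prop
  | cross {l r : List Bool} {a b o : Bool} {x y : List X} {p q p' q' : X}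
      (hx : x.length = l.length) (hy : y.length = r.length)
      (h : CrossingColored a b o p q p' q') :
      Colored (.cross l r a b o) (x ++ p :: q :: y) (x ++ p' :: q' :: y)
  | birth {l r : List Bool} {a : Bool} {x y : List X} {p : X}
      (hx : x.length = l.length) (hy : y.length = r.length) :
      Colored (.birth l r a) (x ++ y) (x ++ p :: p :: y)
  | death {l r : List Bool} {a : Bool} {x y : List X} {p : X}
      (hx : x.length = l.length) (hy : y.length = r.length) :
      Colored (.death l r a) (x ++ p :: p :: y) (x ++ y)

/-- The strip contains a crossing. -/
def Piece.IsCrossing : Piece → Prop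
  | cross .. => True
  | _ => False

theorem Piece.IsCrossing.shift {s : Piece} (h : s.IsCrossing) (x y : List Bool) :
    (s.shift x y).IsCrossing := by
  cases s <;> exact h

namespace Piece.Colored

variable {s : Piece} {w w' w'' : List X}

theorem flip (h : s.Colored w w') : s.flip.Colored w' w := by
  cases h with
  | cross hx hy h => exact .cross hx hy h.flip
  | birth hx hy => exact .death hx hy
  | death hx hy => exact .birth hx hy

theorem length_bot (h : s.Colored w w') : w'.length = s.bot.length := by
  cases h <;> simp_all [Piece.bot]

theorem shift (h : s.Colored w w') {x y : List X} {u v : List Bool} (hx : x.length = u.length)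
    (hy : y.length = v.length) : (s.shift u v).Colored (x ++ w ++ y) (x ++ w' ++ y) := by
  cases h with
  | @cross l r _ _ _ x₁ y₁ _ _ _ _ hx₁ hy₁ h =>
    simpa [Piece.shift] using Colored.cross (l := u ++ l) (r := r ++ v) (x := x ++ x₁)
      (y := y₁ ++ y) (by simp [hx, hx₁]) (by simp [hy, hy₁]) h
  | @birth l r a x₁ y₁ p hx₁ hy₁ =>
    simpa [Piece.shift] using Colored.birth (l := u ++ l) (r := r ++ v) (a := a) (p := p)
      (x := x ++ x₁) (y := y₁ ++ y) (by simp [hx, hx₁]) (by simp [hy, hy₁])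
  | @death l r a x₁ y₁ p hx₁ hy₁ =>
    simpa [Piece.shift] using Colored.death (l := u ++ l) (r := r ++ v) (a := a) (p := p)
      (x := x ++ x₁) (y := y₁ ++ y) (by simp [hx, hx₁]) (by simp [hy, hy₁])

theorem bot_unique (hs : s.IsCrossing) (h : s.Colored w w') (h' : s.Colored w w'') :
    w' = w'' := by
  cases h with
  | birth | death => exact hs.elim
  | @cross _ _ _ _ _ x y p q _ _ hx hy h =>
    generalize hw : x ++ p :: q :: y = w at h'
    cases h' with
    | cross hx' hy' h' =>
      obtain ⟨rfl, e⟩ := List.append_inj hw (hx.trans hx'.symm)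
      simp only [List.cons.injEq] at e
      obtain ⟨rfl, rfl, rfl⟩ := e
      obtain ⟨rfl, rfl⟩ := h.bot_unique h'
      rfl

theorem getElem?_through (h : s.Colored w w') {i k : ℕ} (ht : s.Through i k) :
    w[i]? = w'[k]? := by
  have birth {x y : List X} {p : X} {i k : ℕ}
      (ht : (i < x.length ∧ k = i) ∨ (x.length ≤ i ∧ k = i + 2)) :
      (x ++ y)[i]? = (x ++ p :: p :: y)[k]? := by
    rcases ht with ⟨hi, rfl⟩ | ⟨hi, rfl⟩
    · rw [List.getElem?_append_left hi, List.getElem?_append_left hi]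
    · obtain ⟨m, rfl⟩ := Nat.exists_eq_add_of_le hi
      simp [List.getElem?_append_right, add_assoc]
  cases h with
  | @cross _ _ _ _ _ x _ _ _ _ _ hx _ _ =>
    obtain ⟨rfl, hi, hi'⟩ := ht
    rw [← hx] at hi hi'
    rcases lt_or_ge i x.length with h | h
    · rw [List.getElem?_append_left h, List.getElem?_append_left h]
    · obtain ⟨m, rfl⟩ : ∃ m, i = x.length + (m + 2) := ⟨i - x.length - 2, by omega⟩
      simp [List.getElem?_append_right]
  | birth hx _ =>
    rw [Piece.Through, ← hx] at ht
    exact birth ht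
  | death hx _ =>
    rw [Piece.Through, ← hx] at ht
    exact (birth (ht.imp id id)).symm

theorem getElem?_joinedBelow (h : s.Colored w w') {i k : ℕ} (ht : s.JoinedBelow i k) :
    w'[i]? = w'[k]? := by
  cases h with
  | birth hx _ =>
    obtain ⟨rfl, rfl⟩ := ht
    simp [← hx]
  | cross | death => exact ht.elim

theorem getElem?_joinedAbove (h : s.Colored w w') {i k : ℕ} (ht : s.JoinedAbove i k) :
    w[i]? = w[k]? := by
  cases h with
  | death hx _ =>
    obtain ⟨rfl, rfl⟩ := ht
    simp [← hx]
  | cross | birth => exact ht.elim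

end Piece.Colored

theorem Piece.Colored.crossingColored {l r : List Bool} {a b o : Bool} {w w' : List X}
    {p q p' q' : X} (h : (Piece.cross l r a b o).Colored w w') (hp : w[l.length]? = some p)
    (hq : w[l.length + 1]? = some q) (hp' : w'[l.length]? = some p')
    (hq' : w'[l.length + 1]? = some q') : CrossingColored a b o p q p' q' := by
  cases h with
  | cross hx hy h =>
    obtain rfl : _ = p := by simpa [← hx] using hp
    obtain rfl : _ = q := by simpa [← hx] using hq
    obtain rfl : _ = p' := by simpa [← hx] using hp'
    obtain rfl : _ = q' := by simpa [← hx] using hq'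
    exact h

/-- The words `L 0, L 1, …` are the colors of the strings at the levels of a coloring of the
stack of strips `ps`. -/
def IsLevelColoring (ps : List Piece) (L : ℕ → List X) : Prop :=
  ∀ (j : ℕ) (s : Piece), ps[j]? = some s → s.Colored (L j) (L (j + 1))

theorem isLevelColoring_cons {s : Piece} {ps : List Piece} {L : ℕ → List X} :
    IsLevelColoring (s :: ps) L ↔
      s.Colored (L 0) (L 1) ∧ IsLevelColoring ps fun j => L (j + 1) :=
  ⟨fun h => ⟨h 0 s rfl, fun j t ht => h (j + 1) t ht⟩, fun h j t ht => by
    cases j with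
    | zero => exact Option.some.inj ht ▸ h.1
    | succ j => exact h.2 j t ht⟩

theorem Tangle.word_zero {u v : List Bool} (T : Tangle u v) : T.word 0 = u := by
  rw [Tangle.word]
  cases T.pieces <;> rfl

namespace IsLevelColoring

variable {u v : List Bool} {T : Tangle u v} {L : ℕ → List X}

theorem length_eq (hL : IsLevelColoring T.pieces L) (h0 : (L 0).length = u.length) {j : ℕ}
    (hj : j ≤ T.pieces.length) : (L j).length = (T.word j).length := by
  cases j with
  | zero => rw [T.word_zero, h0]
  | succ j =>
    have hs : T.pieces[j]? = some T.pieces[j] := List.getElem?_eq_getElem hj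
    rw [Tangle.word_bot hs, (hL j _ hs).length_bot]

/-- The color at the position of a point in the words of a level coloring. -/
def pointColor (hL : IsLevelColoring T.pieces L) (h0 : (L 0).length = u.length) (p : T.Point) :
    X :=
  (L p.lvl)[p.pos]'(hL.length_eq h0 p.lvl_le ▸ p.pos_lt)

variable (hL : IsLevelColoring T.pieces L) (h0 : (L 0).length = u.length)

theorem getElem?_pointColor (p : T.Point) :
    (L p.lvl)[p.pos]? = some (hL.pointColor h0 p) :=
  List.getElem?_eq_getElem _

theorem pointColor_eq_of_adj {p q : T.Point} (h : T.Adj p q) :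
    hL.pointColor h0 p = hL.pointColor h0 q := by
  obtain ⟨j, s, hs, h⟩ := h
  apply Option.some.inj
  rw [← hL.getElem?_pointColor, ← hL.getElem?_pointColor]
  rcases h with ⟨hp, hq, h⟩ | ⟨hp, hq, h⟩ | ⟨hp, hq, h⟩ <;> rw [hp, hq]
  exacts [(hL j s hs).getElem?_through h, (hL j s hs).getElem?_joinedBelow h,
    (hL j s hs).getElem?_joinedAbove h]

theorem crossingRule (c : T.Crossing) {f : T.SemiArc → X}
    (hf : ∀ p : T.Point, f p.semiArc = hL.pointColor h0 p) :
    CrossingRule (f c.underSrc) (f c.overSrc) (f c.underTgt) (f c.overTgt) := by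
  rw [← crossingColored_iff, hf, hf, hf, hf]
  exact (hL _ _ c.get_eq).crossingColored (hL.getElem?_pointColor h0 c.topLeft)
    (hL.getElem?_pointColor h0 c.topRight) (hL.getElem?_pointColor h0 c.botLeft)
    (hL.getElem?_pointColor h0 c.botRight)

/-- The coloring of a tangle with given colors at the levels. -/
def coloring : Coloring X T where
  color := Quot.lift (hL.pointColor h0) fun _ _ => hL.pointColor_eq_of_adj h0
  under_eq c := (hL.crossingRule h0 c fun _ => rfl).1
  over_eq c := (hL.crossingRule h0 c fun _ => rfl).2

theorem level_coloring {j : ℕ} (hj : j ≤ T.pieces.length) : (hL.coloring h0).level j = L j := by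
  refine List.ext_getElem ?_ fun i _ _ => ?_
  · rw [Coloring.level, List.length_ofFn, hL.length_eq h0 hj]
  · exact List.getElem_ofFn _

end IsLevelColoring

namespace Coloring

variable {u v : List Bool} {T : Tangle u v} (C : Coloring X T)

theorem length_level (j : ℕ) : (C.level j).length = (T.word j).length :=
  List.length_ofFn

theorem getElem?_level (p : T.Point) : (C.level p.lvl)[p.pos]? = some (C.color p.semiArc) := by
  rw [level, List.getElem?_ofFn, dif_pos p.pos_lt]

theorem ext_level {C C' : Coloring X T} (h : ∀ j ≤ T.pieces.length, C.level j = C'.level j) :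
    C = C' := by
  ext ⟨p⟩
  have color_eq := C.getElem?_level p
  rw [h _ p.lvl_le, C'.getElem?_level] at color_eq
  exact (Option.some.inj color_eq).symm

theorem getElem?_level_of_adj {p q : T.Point} (h : T.Adj p q) :
    (C.level p.lvl)[p.pos]? = (C.level q.lvl)[q.pos]? := by
  rw [C.getElem?_level, C.getElem?_level, show p.semiArc = q.semiArc from Quot.sound h]

theorem getElem?_level_through {j i k : ℕ} {s : Piece} (hs : T.pieces[j]? = some s)
    (h : s.Through i k) : (C.level j)[i]? = (C.level (j + 1))[k]? := by
  have dir_eq : (T.word j)[i]? = (T.word (j + 1))[k]? := by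
    rw [Tangle.word_top hs, Tangle.word_bot hs, h.getElem?]
  rcases lt_or_ge i (T.word j).length with hi | hi
  · have hk : k < (T.word (j + 1)).length := by
      by_contra hk
      rw [List.getElem?_eq_getElem hi, List.getElem?_eq_none (not_lt.1 hk)] at dir_eq
      exact Option.some_ne_none _ dir_eq
    exact C.getElem?_level_of_adj (p := ⟨j, i, hi⟩) (q := ⟨j + 1, k, hk⟩)
      ⟨j, s, hs, Or.inl ⟨rfl, rfl, h⟩⟩
  · have hk : (T.word (j + 1)).length ≤ k := by
      rwa [List.getElem?_eq_none hi, eq_comm, List.getElem?_eq_none_iff] at dir_eq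
    rw [List.getElem?_eq_none (by rwa [C.length_level]),
      List.getElem?_eq_none (by rwa [C.length_level])]

end Coloring

theorem exists_eq_append_cons_cons {α : Type*} {w : List α} {m n : ℕ}
    (h : w.length = m + (n + 1 + 1)) :
    ∃ x p q y, x.length = m ∧ y.length = n ∧ w = x ++ p :: q :: y := by
  refine ⟨w.take m, w[m], w[m + 1], w.drop (m + 2), by simp; omega, by simp; omega, ?_⟩
  rw [← List.drop_eq_getElem_cons, ← List.drop_eq_getElem_cons, List.take_append_drop]

theorem Piece.colored_cross_of_getElem? {l r : List Bool} {a b o : Bool} {w w' : List X}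
    {p q p' q' : X} (hw : w.length = (cross l r a b o).top.length)
    (hw' : w'.length = (cross l r a b o).bot.length)
    (through : ∀ i k, (cross l r a b o).Through i k → w[i]? = w'[k]?)
    (hp : w[l.length]? = some p) (hq : w[l.length + 1]? = some q)
    (hp' : w'[l.length]? = some p') (hq' : w'[l.length + 1]? = some q')
    (h : CrossingColored a b o p q p' q') : (cross l r a b o).Colored w w' := by
  simp only [top, bot, List.length_append, List.length_cons] at hw hw'
  obtain ⟨x, p₁, q₁, y, hx, hy, rfl⟩ := exists_eq_append_cons_cons hw
  obtain ⟨x', p₁', q₁', y', hx', hy', rfl⟩ := exists_eq_append_cons_cons hw'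
  obtain rfl : p₁ = p := by simpa [← hx] using hp
  obtain rfl : q₁ = q := by simpa [← hx] using hq
  obtain rfl : p₁' = p' := by simpa [← hx'] using hp'
  obtain rfl : q₁' = q' := by simpa [← hx'] using hq'
  have left : x = x' := List.ext_getElem (hx.trans hx'.symm) fun i hi hi' => by
    have e := through i i ⟨rfl, by omega, by omega⟩
    simpa [List.getElem?_append_left, hi, hi'] using e
  subst left
  have right : y = y' := List.ext_getElem (hy.trans hy'.symm) fun i hi hi' => by
    have e := through (x.length + (i + 2)) _ ⟨rfl, by omega, by omega⟩
    simpa [hi, hi'] using e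
  exact right ▸ .cross hx hy h

theorem Piece.colored_birth_of_getElem? {l r : List Bool} {a : Bool} {w w' : List X}
    (hw : w.length = (birth l r a).top.length) (hw' : w'.length = (birth l r a).bot.length)
    (through : ∀ i k, (birth l r a).Through i k → w[i]? = w'[k]?)
    (joined : w'[l.length]? = w'[l.length + 1]?) : (birth l r a).Colored w w' := by
  simp only [top, bot, List.length_append, List.length_cons] at hw hw'
  obtain ⟨x, y, rfl, hx⟩ : ∃ x y, w = x ++ y ∧ x.length = l.length :=
    ⟨w.take l.length, w.drop l.length, (List.take_append_drop _ _).symm, by simp; omega⟩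
  have hy : y.length = r.length := by simpa [hx] using hw
  obtain ⟨x', p, q, y', hx', hy', rfl⟩ := exists_eq_append_cons_cons hw'
  obtain rfl : p = q := by simpa [← hx'] using joined
  have left : x = x' := List.ext_getElem (hx.trans hx'.symm) fun i hi hi' => by
    have e := through i i (Or.inl ⟨by omega, rfl⟩)
    simpa [List.getElem?_append_left, hi, hi'] using e
  subst left
  have right : y = y' := List.ext_getElem (hy.trans hy'.symm) fun i hi hi' => by
    have e := through (x.length + i) _ (Or.inr ⟨by omega, rfl⟩)
    simpa [hi, hi', add_assoc] using e
  exact right ▸ .birth hx hy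

theorem Coloring.isLevelColoring_level {u v : List Bool} {T : Tangle u v} (C : Coloring X T) :
    IsLevelColoring T.pieces C.level := by
  intro j s hs
  have length_top : (C.level j).length = s.top.length := by
    rw [C.length_level, Tangle.word_top hs]
  have length_bot : (C.level (j + 1)).length = s.bot.length := by
    rw [C.length_level, Tangle.word_bot hs]
  cases s with
  | cross l r a b o =>
    let c : T.Crossing := ⟨j, l, r, a, b, o, hs⟩
    exact Piece.colored_cross_of_getElem? length_top length_bot
      (fun _ _ => C.getElem?_level_through hs) (C.getElem?_level c.topLeft)
      (C.getElem?_level c.topRight) (C.getElem?_level c.botLeft) (C.getElem?_level c.botRight)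
      ((crossingColored_iff c C.color).2 ⟨C.under_eq c, C.over_eq c⟩)
  | birth l r a =>
    have hp : l.length + 1 < (T.word (j + 1)).length := by rw [Tangle.word_bot hs]; simp [Piece.bot]
    exact Piece.colored_birth_of_getElem? length_top length_bot
      (fun _ _ => C.getElem?_level_through hs)
      (C.getElem?_level_of_adj (p := ⟨j + 1, l.length, by omega⟩) (q := ⟨j + 1, l.length + 1, hp⟩)
        ⟨j, _, hs, Or.inr (Or.inl ⟨rfl, rfl, rfl, rfl⟩)⟩)
  | death l r a =>
    have hp : l.length + 1 < (T.word j).length := by rw [Tangle.word_top hs]; simp [Piece.top]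
    exact (Piece.colored_birth_of_getElem? (l := l) (r := r) (a := a) length_bot length_top
      (fun _ _ ht => (C.getElem?_level_through hs (ht.imp id id)).symm)
      (C.getElem?_level_of_adj (p := ⟨j, l.length, by omega⟩) (q := ⟨j, l.length + 1, hp⟩)
        ⟨j, _, hs, Or.inr (Or.inr ⟨rfl, rfl, rfl, rfl⟩)⟩)).flip

end PieceColored

section StackColored

variable {X : Type u} [Biquandle X] {ps qs : List Piece} {w w' w'' : List X}

/-- `StackColored ps w w'`: a coloring of the stack of strips `ps` exists in which the strings at
the top have the colors `w` and those at the bottom the colors `w'`. -/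
inductive StackColored : List Piece → List X → List X → Prop
  | nil {w : List X} : StackColored [] w w
  | cons {s : Piece} {ps : List Piece} {w w' w'' : List X} (h : s.Colored w w')
      (h' : StackColored ps w' w'') : StackColored (s :: ps) w w''

namespace StackColored

theorem append (h : StackColored ps w w') (h' : StackColored qs w' w'') :
    StackColored (ps ++ qs) w w'' := by
  induction h with
  | nil => exact h'
  | cons h _ ih => exact .cons h (ih h')

theorem flip (h : StackColored ps w w') :
    StackColored (ps.map Piece.flip).reverse w' w := by
  induction h with
  | nil => exact .nil
  | cons h _ ih =>
    rw [List.map_cons, List.reverse_cons]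
    exact ih.append (.cons h.flip .nil)

theorem shift (h : StackColored ps w w') {x y : List X} {u v : List Bool}
    (hx : x.length = u.length) (hy : y.length = v.length) :
    StackColored (ps.map (Piece.shift u v)) (x ++ w ++ y) (x ++ w' ++ y) := by
  induction h with
  | nil => exact .nil
  | cons h _ ih => exact .cons (h.shift hx hy) ih

theorem bot_unique (hps : ∀ s ∈ ps, s.IsCrossing) (h : StackColored ps w w')
    (h' : StackColored ps w w'') : w' = w'' := by
  induction h with
  | nil => cases h'; rfl
  | cons h _ ih =>
    obtain ⟨hs, hps⟩ := List.forall_mem_cons.1 hps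
    cases h' with
    | cons h₁ h₁' =>
      obtain rfl := h.bot_unique hs h₁
      exact ih hps h₁'

theorem exists_isLevelColoring_append {N : ℕ → List X} (h : StackColored ps w (N 0))
    (hN : IsLevelColoring qs N) :
    ∃ M, IsLevelColoring (ps ++ qs) M ∧ M 0 = w ∧ ∀ j, M (ps.length + j) = N j := by
  generalize hw' : N 0 = w' at h
  induction h with
  | nil => exact ⟨N, hN, hw', fun j => by rw [List.length_nil, Nat.zero_add]⟩
  | @cons _ ps w _ _ h _ ih =>
    obtain ⟨M, hM, h0, hMN⟩ := ih hw'
    subst h0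
    refine ⟨fun j => j.casesOn w M, isLevelColoring_cons.2 ⟨h, hM⟩, rfl, fun j => ?_⟩
    rw [List.length_cons, Nat.add_right_comm]
    exact hMN j

theorem exists_isLevelColoring (h : StackColored ps w w') :
    ∃ M, IsLevelColoring ps M ∧ M 0 = w ∧ M ps.length = w' := by
  obtain ⟨M, hM, h0, h1⟩ := exists_isLevelColoring_append (qs := []) (N := fun _ => w') h
    (fun _ _ hs => by simp at hs)
  exact ⟨M, List.append_nil ps ▸ hM, h0, h1 0⟩

theorem exists_isLevelColoring_flatMap (f : Piece → List Piece) {L : ℕ → List X}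
    (h : ∀ j s, ps[j]? = some s → StackColored (f s) (L j) (L (j + 1))) :
    ∃ M, IsLevelColoring (ps.flatMap f) M ∧
      ∀ j ≤ ps.length, M ((ps.take j).flatMap f).length = L j := by
  induction ps generalizing L with
  | nil => exact ⟨L, fun _ _ hs => by simp at hs, by simp⟩
  | cons s ps ih =>
    obtain ⟨N, hN, hNL⟩ := ih (L := fun j => L (j + 1)) fun j t ht => h (j + 1) t ht
    have h1 : N 0 = L 1 := hNL 0 (Nat.zero_le _)
    obtain ⟨M, hM, h0, hMN⟩ := exists_isLevelColoring_append (h1 ▸ h 0 s rfl) hN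
    refine ⟨M, hM, fun j hj => ?_⟩
    cases j with
    | zero => exact h0
    | succ j =>
      rw [List.take_succ_cons, List.flatMap_cons, List.length_append, hMN]
      exact hNL j (Nat.le_of_succ_le_succ hj)

end StackColored

theorem IsLevelColoring.stackColored {L : ℕ → List X} (h : IsLevelColoring (ps ++ qs) L) :
    StackColored ps (L 0) (L ps.length) := by
  induction ps generalizing L with
  | nil => exact .nil
  | cons s ps ih =>
    obtain ⟨hs, h⟩ := isLevelColoring_cons.1 h
    exact .cons hs (ih h)

end StackColored

/-! ### Pulling away the reversed link -/

section Dup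

variable {α β : Type*} (f : α → β)

/-- The colors of the doubled strings if the strings have the colors `c` and both strings parallel
to a string of color `a` receive the color `f a`. -/
def dup (c : List α) : List β :=
  c.flatMap fun a => [f a, f a]

theorem dup_cons (a : α) (c : List α) : dup f (a :: c) = f a :: f a :: dup f c :=
  rfl

theorem dup_append (c c' : List α) : dup f (c ++ c') = dup f c ++ dup f c' :=
  List.flatMap_append

theorem length_dup {c : List α} {u : List Bool} (h : c.length = u.length) :
    (dup f c).length = (dbl u).length := by
  simp only [dup, dbl, List.length_flatMap, List.length_cons, List.length_nil, List.map_const',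
    List.sum_replicate, h]

end Dup

section Pull

variable {X : Type u} [Biquandle X]

/-- The new color of two parallel strings of color `x` behind which a string of orientation `d` and
color `z` has been moved to the right. -/
noncomputable def slideColor (d : Bool) (z x : X) : X :=
  if d then overInv x z else Biquandle.ost x z

/-- The color of the two strings parallel to a string of orientation `d` after the left one has been
moved behind the right one if it belongs to `-D^v`, where `x` is their former color. -/
noncomputable def frontColor (d : Bool) (x : X) : X :=
  if d then x else kMap x

theorem exists_crossingColored_slide (d : Bool) (z x : X) :
    ∃ m, CrossingColored d true false z x (slideColor d z x) m ∧
      CrossingColored d false false m x (slideColor d z x) z := by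
  cases d
  · exact ⟨Biquandle.ust z x, ⟨rfl, rfl⟩, rfl, rfl⟩
  · exact ⟨Biquandle.ust z (overInv x z), ⟨rfl, over_overInv x z⟩, rfl, over_overInv x z⟩

theorem crossingColored_kMap (z : X) : CrossingColored true false false z z (kMap z) (kMap z) :=
  ⟨(Biquandle.under_self _).trans (over_kMap z), over_kMap z⟩

theorem slideBehind_isCrossing (x : List Bool) (d : Bool) (w : List Bool) :
    ∀ s ∈ slideBehind x d w, s.IsCrossing := by
  induction w generalizing x with
  | nil => exact List.forall_mem_nil _
  | cons b w ih => exact List.forall_mem_cons.2 ⟨trivial, ih _⟩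

theorem pullPieces_isCrossing (u : List Bool) : ∀ s ∈ pullPieces u, s.IsCrossing := by
  induction u with
  | nil => exact List.forall_mem_nil _
  | cons d u ih =>
    rw [pullPieces, List.forall_mem_append, List.forall_mem_map]
    refine ⟨?_, fun s hs => (ih s hs).shift _ _⟩
    split <;> exact slideBehind_isCrossing _ _ _

theorem stackColored_slideBehind {α : Type*} (f : α → X) (d : Bool) (z : X) {x u : List Bool}
    {cx : List X} {c : List α} (hx : cx.length = x.length) (hc : c.length = u.length) :
    StackColored (slideBehind x d (dbl u)) (cx ++ z :: dup f c)
      (cx ++ dup (slideColor d z ∘ f) c ++ [z]) := by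
  induction u generalizing x cx c with
  | nil =>
    obtain rfl := List.length_eq_zero_iff.1 hc
    rw [List.append_assoc]
    exact .nil
  | cons b u ih =>
    obtain ⟨a, c, rfl⟩ := List.exists_cons_of_length_eq_add_one hc
    have hc : c.length = u.length := Nat.succ.inj hc
    obtain ⟨m, first, second⟩ := exists_crossingColored_slide d z (f a)
    have hdup := length_dup f hc
    have rest := ih (x := x ++ [true] ++ [false])
      (cx := cx ++ [slideColor d z (f a)] ++ [slideColor d z (f a)]) (by simp [hx]) hc
    rw [show dbl (b :: u) = true :: false :: dbl u from rfl, dup_cons]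
    refine .cons (.cross hx (congrArg (· + 1) hdup) first) ?_
    rw [List.append_cons cx]
    refine .cons (.cross (by simp [hx]) hdup second) ?_
    simpa only [dup_cons, Function.comp_apply, List.append_assoc, List.cons_append,
      List.nil_append] using rest

theorem stackColored_pull_first {α : Type*} (f : α → X) (d : Bool) (a : α) {u : List Bool}
    {c : List α} (hc : c.length = u.length) :
    StackColored
      (if d then slideBehind [true] false (dbl u) else slideBehind [] true (false :: dbl u))
      (dup f (a :: c))
      (frontColor d (f a) :: dup (slideColor (!d) (frontColor d (f a)) ∘ f) c ++
        [frontColor d (f a)]) := by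
  cases d
  · exact .cons (.cross (x := []) rfl (length_dup f hc) (crossingColored_kMap (f a)))
      (stackColored_slideBehind f true (kMap (f a)) (x := [false]) (cx := [kMap (f a)]) rfl hc)
  · exact stackColored_slideBehind f false (f a) (x := [true]) (cx := [f a]) rfl hc

theorem slideColor_psi (p : As (Qdl X)) (d : Bool) (a b : Qdl X) :
    slideColor (!d) (frontColor d (psi p a)) (psi p b) =
      psi (p * if d then As.of a else (As.of a)⁻¹) b := by
  cases d
  · exact (psi_mul_of_inv p a b).symm
  · exact (psi_mul_of p a b).symm

variable {u v : List Bool} {T : Tangle u v}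

theorem Coloring.regionColor_specified (C : Coloring X T) (p : T.Point) :
    C.regionColor p.semiArc.specified =
      C.gapColor p.lvl p.pos * if p.dir then 1 else C.sign p := by
  change C.gapColor p.srcGap.lvl p.srcGap.pos = _
  cases hd : p.dir
  · simp [hd, Tangle.Point.srcGap, Tangle.Point.rightGap, C.gapColor_succ]
  · simp [hd, Tangle.Point.srcGap, Tangle.Point.leftGap]

theorem QColoring.psiColoring_color_point (C : QColoring (Qdl X) T) (p : T.Point) :
    C.psiColoring.color p.semiArc =
      frontColor p.dir (psi (C.toColoring.gapColor p.lvl p.pos)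
        (C.toColoring.color p.semiArc)) := by
  rw [C.psiColoring_color, C.toColoring.regionColor_specified, Coloring.sign]
  cases p.dir
  · exact psi_mul_of_inv_self _ _
  · exact congrArg (psi · _) (mul_one _)

theorem Coloring.drop_level (C : Coloring X T) {j i : ℕ} (hi : i < (T.word j).length) :
    (C.level j).drop i = C.color (Tangle.Point.semiArc ⟨j, i, hi⟩) :: (C.level j).drop (i + 1) := by
  rw [List.drop_eq_getElem_cons (by rwa [C.length_level])]
  exact congrArg (· :: _) (List.getElem_ofFn _)

/-- After the strings of `-D^v` parallel to the first `i` strings have been pulled away, the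
remaining pairs of parallel strings have the colors prescribed by `ψ(p, ·)` for the color `p` of
the gap behind these `i` strings. -/
theorem QColoring.stackColored_pullPieces_drop (C : QColoring (Qdl X) T) (j : ℕ) {i : ℕ}
    (hi : i ≤ (T.word j).length) :
    StackColored (pullPieces ((T.word j).drop i))
      (dup (psi (C.toColoring.gapColor j i)) ((C.toColoring.level j).drop i))
      ((C.psiColoring.level j).drop i ++ ((C.psiColoring.level j).drop i).reverse) := by
  induction hi using Nat.decreasingInduction with
  | self =>
    rw [List.drop_length, List.drop_of_length_le (C.toColoring.length_level j).le,
      List.drop_of_length_le (C.psiColoring.length_level j).le]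
    exact .nil
  | of_succ i hi ih =>
    let p : T.Point := ⟨j, i, hi⟩
    have word_drop : (T.word j).drop i = p.dir :: (T.word j).drop (i + 1) :=
      List.drop_eq_getElem_cons hi
    have slide : slideColor (!p.dir) (C.psiColoring.color p.semiArc) ∘
        psi (C.toColoring.gapColor j i) = psi (C.toColoring.gapColor j (i + 1)) := by
      funext b
      rw [C.toColoring.gapColor_add_one hi, C.psiColoring_color_point]
      exact slideColor_psi _ _ _ b
    have first := stackColored_pull_first (psi (C.toColoring.gapColor j i)) p.dir
      (C.toColoring.color p.semiArc) (c := (C.toColoring.level j).drop (i + 1))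
      (u := (T.word j).drop (i + 1))
      (by rw [List.length_drop, List.length_drop, Coloring.length_level])
    rw [← C.psiColoring_color_point p, slide] at first
    have rest := ih.shift (x := [C.psiColoring.color p.semiArc])
      (y := [C.psiColoring.color p.semiArc]) (u := [p.dir]) (v := [!p.dir]) rfl rfl
    rw [C.psiColoring.drop_level hi, C.toColoring.drop_level hi, word_drop, pullPieces]
    simpa only [List.cons_append, List.reverse_cons, List.append_assoc, List.nil_append] using
      first.append rest

theorem QColoring.stackColored_pullPieces (C : QColoring (Qdl X) T) (j : ℕ) :
    StackColored (pullPieces (T.word j)) (dup Qdl.out (C.toColoring.level j))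
      (C.psiColoring.level j ++ (C.psiColoring.level j).reverse) := by
  have h := C.stackColored_pullPieces_drop j (Nat.zero_le _)
  rwa [List.drop_zero, List.drop_zero, List.drop_zero,
    show psi (C.toColoring.gapColor j 0) = Qdl.out from funext psi_one] at h

end Pull

/-! ### The doubled diagram -/

section Double

variable {X : Type u} [Biquandle X]

theorem CrossingColored.exists_double {a b o : Bool} {p q p' q' : Qdl X}
    (h : CrossingColored a b o p q p' q') :
    ∃ m₁ m₂ n₁ n₂ : X,
      CrossingColored false true (dblOver o (!a) b) p.out q.out m₁ m₂ ∧
      CrossingColored true true (dblOver o a b) p.out m₁ p'.out n₁ ∧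
      CrossingColored false false (dblOver o (!a) (!b)) m₂ q.out n₂ q'.out ∧
      CrossingColored true false (dblOver o a (!b)) n₁ n₂ p'.out q'.out := by
  have out_under (x y : Qdl X) : (Biquandle.ust x y).out = qop x.out y.out := rfl
  have out_overline (x y : Qdl X) : (Biquandle.ost x y).out = x.out := rfl
  -- `m₁`, `m₂` are determined by `p`, `q` and `n₁`, `n₂` by `p'`, `q'`.
  refine ⟨if dblOver o (!a) b then Biquandle.ust q.out p.out else Biquandle.ost q.out p.out,
    if dblOver o (!a) b then Biquandle.ost p.out q.out else Biquandle.ust p.out q.out,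
    if dblOver o a (!b) then Biquandle.ost q'.out p'.out else Biquandle.ust q'.out p'.out,
    if dblOver o a (!b) then Biquandle.ust p'.out q'.out else Biquandle.ost p'.out q'.out, ?_⟩
  cases a <;> cases b <;> cases o <;> obtain ⟨h₁, h₂⟩ := h <;>
    simp only [Bool.false_eq_true, if_true, if_false] at h₁ h₂ <;>
    subst h₁ h₂ <;>
    simp [CrossingColored, CrossingRule, dblOver, out_under, out_overline, over_qop]

theorem stackColored_double_birth {l r : List Bool} {x y : List X} {p : X}
    (hx : x.length = (dbl l).length) (hy : y.length = (dbl r).length) :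
    StackColored [.birth (dbl l) (dbl r) true, .birth (dbl l ++ [true]) (false :: dbl r) false]
      (x ++ y) (x ++ p :: p :: p :: p :: y) := by
  have inner := Piece.Colored.birth (l := dbl l ++ [true]) (r := false :: dbl r) (a := false)
    (x := x ++ [p]) (y := p :: y) (p := p) (by simp [hx]) (by simp [hy])
  simp only [List.append_assoc, List.cons_append, List.nil_append] at inner
  exact .cons (.birth hx hy) (.cons inner .nil)

theorem Piece.Colored.stackColored_double {s : Piece} {w w' : List (Qdl X)}
    (h : s.Colored w w') : StackColored s.double (dup Qdl.out w) (dup Qdl.out w') := by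
  cases h with
  | @cross l r _ _ _ x y p q p' q' hx hy h =>
    obtain ⟨m₁, m₂, n₁, n₂, h₁, h₂, h₃, h₄⟩ := h.exists_double
    have hx := length_dup Qdl.out hx
    have hy := length_dup Qdl.out hy
    have colored₁ := Piece.Colored.cross (l := dbl l ++ [true]) (r := false :: dbl r)
      (x := dup Qdl.out x ++ [p.out]) (y := q.out :: dup Qdl.out y) (by simp [hx]) (by simp [hy]) h₁
    have colored₂ := Piece.Colored.cross (r := false :: false :: dbl r)
      (y := m₂ :: q.out :: dup Qdl.out y) hx (by simp [hy]) h₂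
    have colored₃ := Piece.Colored.cross (l := dbl l ++ [true, true])
      (x := dup Qdl.out x ++ [p'.out, n₁]) (by simp [hx]) hy h₃
    have colored₄ := Piece.Colored.cross (l := dbl l ++ [true]) (r := false :: dbl r)
      (x := dup Qdl.out x ++ [p'.out]) (y := q'.out :: dup Qdl.out y) (by simp [hx]) (by simp [hy])
      h₄
    simp only [List.append_assoc, List.cons_append, List.nil_append] at colored₁ colored₃ colored₄
    simp only [dup_append, dup_cons]
    exact .cons colored₁ (.cons colored₂ (.cons colored₃ (.cons colored₄ .nil)))
  | birth hx hy =>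
    simp only [dup_append, dup_cons]
    exact stackColored_double_birth (length_dup _ hx) (length_dup _ hy)
  | death hx hy =>
    simp only [dup_append, dup_cons]
    exact (stackColored_double_birth (length_dup _ hx) (length_dup _ hy)).flip

theorem QColoring.exists_isDoubling {D : LinkDiagram} (C : QColoring (Qdl X) D) :
    ∃ E : Coloring X D.doubled, IsDoubling C E := by
  obtain ⟨M, hM, level_eq⟩ := StackColored.exists_isLevelColoring_flatMap Piece.double
    (L := fun j => dup Qdl.out (C.toColoring.level j)) fun j s hs =>
      (C.toColoring.isLevelColoring_level j s hs).stackColored_double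
  have level_zero : C.toColoring.level 0 = [] := by
    rw [← List.length_eq_zero_iff, Coloring.length_level, D.word_zero, List.length_nil]
  have hM0 : M 0 = [] := (level_eq 0 (Nat.zero_le _)).trans (congrArg (dup Qdl.out) level_zero)
  refine ⟨IsLevelColoring.coloring (T := D.doubled) hM (congrArg List.length hM0), fun j hj => ?_⟩
  have doubledLevel_le : D.doubledLevel j ≤ D.doubled.pieces.length :=
    ((List.take_prefix j D.pieces).flatMap Piece.double).length_le
  exact (IsLevelColoring.level_coloring (T := D.doubled) hM _ doubledLevel_le).trans
    (level_eq j hj)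

end Double

/-! ### The pulling away map -/

section PullingAway

variable {X : Type u} [Biquandle X] {u : List Bool} {w m : List X}

theorem exists_coloring_pulledStrip (hw : w.length = (dbl u).length)
    (h : StackColored (pullPieces u) w m) :
    ∃ F : Coloring X (pulledStrip u), F.level 0 = w ∧
      F.level (pulledStrip u).pieces.length = w ∧ F.level (pullPieces u).length = m := by
  obtain ⟨N, hN, hN0, hN1⟩ := h.flip.exists_isLevelColoring
  obtain ⟨M, hM, hM0, hMN⟩ := StackColored.exists_isLevelColoring_append (hN0.symm ▸ h) hN
  have level_eq {j : ℕ} (hj : j ≤ (pulledStrip u).pieces.length) :=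
    IsLevelColoring.level_coloring (T := pulledStrip u) hM (by rw [hM0, hw]) hj
  have length_pieces : (pulledStrip u).pieces.length =
      (pullPieces u).length + ((pullPieces u).map Piece.flip).reverse.length :=
    List.length_append
  refine ⟨_, (level_eq (Nat.zero_le _)).trans hM0, (level_eq le_rfl).trans ?_,
    (level_eq (by omega)).trans ((hMN 0).trans hN0)⟩
  rw [length_pieces, hMN, hN1]

theorem Coloring.level_pulledStrip (F : Coloring X (pulledStrip u))
    (h : StackColored (pullPieces u) (F.level 0) m) :
    F.level (pullPieces u).length = m :=
  F.isLevelColoring_level.stackColored.bot_unique (pullPieces_isCrossing u) h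

theorem isPullingAwayMap_psiColoring (X : Type u) [Biquandle X] (D : LinkDiagram) :
    IsPullingAwayMap (QColoring.psiColoring (X := X) (T := D)) := by
  intro C C'
  have pull (j : ℕ) := C.stackColored_pullPieces j
  have take_level (j : ℕ) :
      (C.psiColoring.level j ++ (C.psiColoring.level j).reverse).take (D.word j).length =
        C.psiColoring.level j :=
    List.take_left' (C.psiColoring.length_level j)
  constructor
  · rintro rfl
    obtain ⟨E, hE⟩ := C.exists_isDoubling
    refine ⟨E, hE, fun j hj => ?_⟩
    obtain ⟨F, top_eq, bot_eq, middle_eq⟩ := exists_coloring_pulledStrip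
      (length_dup Qdl.out (C.toColoring.length_level j)) (pull j)
    rw [hE j hj]
    exact ⟨F, top_eq, bot_eq, by rw [middle_eq, take_level]⟩
  · rintro ⟨E, hE, hC'⟩
    refine Coloring.ext_level fun j hj => ?_
    obtain ⟨F, top_eq, -, middle_eq⟩ := hC' j hj
    have start : F.level 0 = dup Qdl.out (C.toColoring.level j) := top_eq.trans (hE j hj)
    rw [← middle_eq, F.level_pulledStrip (start ▸ pull j), take_level]

end PullingAway

end KnotColor

open KnotColor in
theorem proposition6p2 (X : Type u) [Biquandle X] (D : LinkDiagram) :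
    ∃ Ψ : QColoring (Qdl X) D ≃ Coloring X D,
      IsPullingAwayMap Ψ ∧
      ∀ C : QColoring (Qdl X) D,
        (Ψ C).shadow = psiTilde ∘ C.toColoring.shadow :=
  ⟨psiColoringEquiv X D, isPullingAwayMap_psiColoring X D, QColoring.shadow_psiColoring⟩
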